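/- Let $A$ be a Noetherian semi-local commutative ring such that, for every maximal ideal $M$ of $A$, the local ring $A_M$ is Cohen–Macaulay of Krull dimension one. Let $\mathrm{Q}(A)$ be the total ring of fractions of $A$ and let $\overline{A}$ be the integral closure of $A$ in $\mathrm{Q}(A)$. Then $A$ is strictly closed in $\overline{A}$, i.e. $$A=\{x\in\overline{A} \mid x\otimes 1=1\otimes x \text{ in } \overline{A}\otimes_A\overline{A}\},$$ if and only if $A$ is an Arf ring, i.e. the following two conditions hold: 1. every integrally closed ideal $I$ of $A$ that contains a non-zerodivisor of $A$ has a principal reduction, that is, $I^{n+1}=aI^n$ for some $a\in I$ and some integer $n\ge 0$; 2. if $x,y,z\in A$, $x$ is a non-zerodivisor of $A$, and $y/x,\ z/x\in\mathrm{Q}(A)$ are integral over $A$, then $yz/x\in A$. Here an ideal $I$ is integrally closed if it contains every $x\in A$ that satisfies an equation $x^n+a_1x^{n-1}+\cdots+a_n=0$ with $n\ge 1$ and $a_i\in I^i$ for $1\le i\le n$. -/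

import Mathlib

open scoped TensorProduct nonZeroDivisors

noncomputable section

/-- The depth of a (Noetherian) local ring `R`: the supremum of the lengths of the `R`-regular
sequences contained in the maximal ideal. -/
def localRingDepth (R : Type*) [CommRing R] [IsLocalRing R] : ℕ∞ :=
  ⨆ rs ∈ {rs : List R | (∀ r ∈ rs, r ∈ IsLocalRing.maximalIdeal R) ∧
    RingTheory.Sequence.IsRegular R rs}, (rs.length : ℕ∞)

/-- A Noetherian local ring is Cohen-Macaulay if its depth equals its Krull dimension. -/
structure IsCohenMacaulayLocalRing (R : Type*) [CommRing R] [IsLocalRing R] : Prop where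
  noetherian : IsNoetherianRing R
  depth_eq_dim : (localRingDepth R : WithBot ℕ∞) = ringKrullDim R

/-- The integral closure of `A` in its total ring of fractions `Q(A)`. (`FractionRing A` is the
localization of `A` at the set of all non-zerodivisors; `A` need not be a domain.) -/
abbrev totalIntegralClosure (A : Type*) [CommRing A] : Subalgebra A (FractionRing A) :=
  integralClosure A (FractionRing A)

/-- The strict closure `A*` of `A`: all `x` in the integral closure `B` of `A` in `Q(A)` such that
`x ⊗ 1 = 1 ⊗ x` in `B ⊗[A] B`. -/
def strictClosure (A : Type*) [CommRing A] : Subalgebra A (totalIntegralClosure A) :=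
  AlgHom.equalizer
    (Algebra.TensorProduct.includeLeft :
      totalIntegralClosure A →ₐ[A] totalIntegralClosure A ⊗[A] totalIntegralClosure A)
    (Algebra.TensorProduct.includeRight :
      totalIntegralClosure A →ₐ[A] totalIntegralClosure A ⊗[A] totalIntegralClosure A)

theorem mem_strictClosure {A : Type*} [CommRing A] {x : totalIntegralClosure A} :
    x ∈ strictClosure A ↔ x ⊗ₜ[A] (1 : totalIntegralClosure A) = 1 ⊗ₜ[A] x :=
  Iff.rfl

/-- `A` is strictly closed in its integral closure: the strict closure is (the image of) `A`. -/
def IsStrictlyClosed (A : Type*) [CommRing A] : Prop :=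
  strictClosure A = ⊥

/-- `x` is integral over the ideal `I`: there is an equation
`x ^ n + a₁ x ^ (n - 1) + ⋯ + aₙ = 0` with `n ≥ 1` and `aᵢ ∈ I ^ i`. -/
def Ideal.IsIntegralElem {A : Type*} [CommRing A] (I : Ideal A) (x : A) : Prop :=
  ∃ (n : ℕ) (a : ℕ → A), 1 ≤ n ∧ (∀ i ∈ Finset.Icc 1 n, a i ∈ I ^ i) ∧
    x ^ n + ∑ i ∈ Finset.Icc 1 n, a i * x ^ (n - i) = 0

/-- The ideal `I` is integrally closed: it contains every element of `A` integral over it. -/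
def Ideal.IsIntegrallyClosedIdeal {A : Type*} [CommRing A] (I : Ideal A) : Prop :=
  ∀ x : A, I.IsIntegralElem x → x ∈ I

/-- `I` has a principal reduction: `I ^ (n + 1) = a I ^ n` for some `a ∈ I` and some `n ≥ 0`. -/
def Ideal.HasPrincipalReduction {A : Type*} [CommRing A] (I : Ideal A) : Prop :=
  ∃ a ∈ I, ∃ n : ℕ, I ^ (n + 1) = Ideal.span {a} * I ^ n

/-- The two conditions defining an Arf ring. The notion is used for Noetherian semi-local rings
`A` such that `A_M` is Cohen-Macaulay of dimension one for every maximal ideal `M`. -/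
structure IsArfRing (A : Type*) [CommRing A] : Prop where
  hasPrincipalReduction : ∀ I : Ideal A, (∃ s ∈ I, s ∈ A⁰) → I.IsIntegrallyClosedIdeal →
    I.HasPrincipalReduction
  mul_div_mem : ∀ (x : A⁰) (y z : A),
    IsIntegral A (IsLocalization.mk' (FractionRing A) y x) →
    IsIntegral A (IsLocalization.mk' (FractionRing A) z x) →
    IsLocalization.mk' (FractionRing A) (y * z) x ∈ (algebraMap A (FractionRing A)).range

end

universe u

/-! The Cohen–Macaulay hypothesis enters only through two facts: primes containing a non-zerodivisor
are maximal (`hdim`), and every maximal ideal contains a non-zerodivisor (`hreg`).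

Arf implies strictly closed. An equality `z ⊗ 1 = 1 ⊗ z` already holds over a finite subalgebra `C`,
and `C/A` has finite length, on which one inducts. If `C ≠ A`, choose a maximal `M` with `M(C/A) ≠
C/A`. As `M` is integrally closed, condition 1 gives `a ∈ M` with `a⁻¹M` integral over `A`, and
condition 2 makes `A' = a⁻¹M` a ring, again Arf inside the same `K`. With `C' = A'[C]`,
multiplication by `a` embeds `C'/A'` into `M(C/A)`, so the length drops (`length_adjoin_blowup_lt`).
Modulo `M` the tensor relation gives `z = r + aw` with `r ∈ A`, `w ∈ C'`, and it passes to `w` over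
`A'` (`tmul_eq_tmul_of_smul_tmul_eq`). By induction `w ∈ A'`, hence `aw ∈ M ⊆ A`.

Strictly closed implies Arf. Condition 2 is a direct tensor computation. For condition 1, `I`
becomes principal, `IC = bC`, in a finite extension `C`, because `(1, t)` is invertible over the
integral closure for each `t ∈ K` (`exists_isIntegral_add_mul_eq_one`) and `C` is semi-local. It
remains to find `x ∈ I` with `x/b` a unit of `C`. Residue fields may be small, so general linear
combinations over `A` do not suffice; instead `mul_tmul_one_eq_one_tmul_mul` shows that `y e` is in
the strict closure for `y ∈ I` and suitable approximate idempotents `e ∈ C`, so `x` can be corrected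
at one maximal ideal of `C` at a time. -/

/-! ### Tensor relations modulo a maximal ideal and division by an element -/

/-- Lifting an `A/M`-basis of `X/MX` to `X` gives an exact sequence `⊕M → (⊕A) × MX → X → 0`. After
tensoring with `P`, an element of the kernel of `P ⊗ MX → P ⊗ X` comes from some `η ∈ P ⊗ ⊕M` that
dies in `P ⊗ ⊕A = ⊕P`, so all its components vanish under `P ⊗ M → MP`. By hypothesis `f` sees `η`
only through these components. -/
theorem lTensor_smul_top_apply_eq_zero {A P X N : Type*} [CommRing A] (M : Ideal A) [M.IsMaximal]
    [AddCommGroup P] [Module A P] [AddCommGroup X] [Module A X] [AddCommGroup N] [Module A N]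
    (f : P ⊗[A] (M • ⊤ : Submodule A X) →ₗ[A] N)
    (hf : ∀ v : X, ∃ g : (M • ⊤ : Submodule A P) →ₗ[A] N, ∀ (p : P) (m : A) (hm : m ∈ M),
      f (p ⊗ₜ ⟨m • v, Submodule.smul_mem_smul hm Submodule.mem_top⟩) =
        g ⟨m • p, Submodule.smul_mem_smul hm Submodule.mem_top⟩)
    (ξ : P ⊗[A] (M • ⊤ : Submodule A X))
    (hξ : (M • ⊤ : Submodule A X).subtype.lTensor P ξ = 0) : f ξ = 0 := by
  classical
  let _ := Ideal.Quotient.field M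
  let b := Module.Basis.ofVectorSpace (A ⧸ M) (X ⧸ (M • ⊤ : Submodule A X))
  set ι := Module.Basis.ofVectorSpaceIndex (A ⧸ M) (X ⧸ (M • ⊤ : Submodule A X))
  choose v hv using fun i : ι => Submodule.mkQ_surjective (M • ⊤ : Submodule A X) (b i)
  choose g hg using hf
  let mulV (w : X) : M →ₗ[A] (M • ⊤ : Submodule A X) :=
    (LinearMap.toSpanSingleton A X w ∘ₗ M.subtype).codRestrict _
      fun m => Submodule.smul_mem_smul m.2 Submodule.mem_top
  let μ : P ⊗[A] M →ₗ[A] (M • ⊤ : Submodule A P) := TensorProduct.lift <|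
    LinearMap.mk₂ A (fun p m => ⟨(m : A) • p, Submodule.smul_mem_smul m.2 Submodule.mem_top⟩)
      (fun _ _ _ => Subtype.ext (smul_add _ _ _))
      (fun c p m => Subtype.ext (smul_comm (m : A) c p))
      (fun _ _ _ => Subtype.ext (add_smul _ _ _))
      (fun c p m => Subtype.ext (mul_smul c (m : A) p))
  let Ψ₁ : (ι →₀ M) →ₗ[A] (ι →₀ A) := Finsupp.mapRange.linearMap M.subtype
  let Ψ₂ : (ι →₀ M) →ₗ[A] (M • ⊤ : Submodule A X) := Finsupp.lsum ℕ fun i => mulV (v i)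
  let Φ : (ι →₀ A) × (M • ⊤ : Submodule A X) →ₗ[A] X :=
    (Finsupp.linearCombination A v).coprod (Submodule.subtype _)
  have hmk (x : ι →₀ A) : (M • ⊤ : Submodule A X).mkQ (Finsupp.linearCombination A v x) =
      x.sum fun i a => Ideal.Quotient.mk M a • b i := by
    rw [Finsupp.linearCombination_apply, Finsupp.sum, map_sum, Finsupp.sum]
    refine Finset.sum_congr rfl fun i _ => ?_
    rw [map_smul, hv]; rfl
  have hΨΦ (x : ι →₀ M) : (Finsupp.linearCombination A v (Ψ₁ x)) = Ψ₂ x := by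
    induction x using Finsupp.induction_linear with
    | zero => simp
    | add x y hx hy => simp [hx, hy]
    | single i m => simp [Ψ₁, Ψ₂, mulV]; rfl
  have hex : Function.Exact (Ψ₁.prod (-Ψ₂)) Φ := by
    rintro ⟨x, u⟩
    constructor
    · intro h
      have h0 : x.sum (fun i a => Ideal.Quotient.mk M a • b i) = 0 := by
        rw [← hmk]
        have : Finsupp.linearCombination A v x = -(u : X) := eq_neg_of_add_eq_zero_left h
        rw [this, Submodule.mkQ_apply, Submodule.Quotient.mk_eq_zero]
        exact neg_mem u.2
      have hx : ∀ i, x i ∈ M := by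
        have h1 := linearIndependent_iff'.1 b.linearIndependent x.support
          (fun i => Ideal.Quotient.mk M (x i)) h0
        intro i
        by_cases hi : i ∈ x.support
        · exact Ideal.Quotient.eq_zero_iff_mem.1 (h1 i hi)
        · rw [Finsupp.notMem_support_iff.1 hi]; exact M.zero_mem
      let y : ι →₀ M := Finsupp.onFinset x.support (fun i => ⟨x i, hx i⟩) (by
        intro i hi; rw [Finsupp.mem_support_iff]; intro h; exact hi (Subtype.ext h))
      have hy : Ψ₁ y = x := by ext i; rfl
      refine ⟨y, Prod.ext hy ?_⟩
      have h2 := hΨΦ y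
      rw [hy] at h2
      have h3 : Finsupp.linearCombination A v x + (u : X) = 0 := h
      apply Subtype.ext
      change -((Ψ₂ y : _) : X) = u
      rw [← h2]
      exact (eq_neg_of_add_eq_zero_right h3).symm
    · rintro ⟨y, hy⟩
      rw [← hy]
      simp [Φ, hΨΦ]
  have hsurj : Function.Surjective Φ := by
    intro x
    obtain ⟨c, hc⟩ : ∃ c : ι →₀ A, (M • ⊤ : Submodule A X).mkQ x =
        c.sum fun i a => Ideal.Quotient.mk M a • b i := by
      set r := b.repr ((M • ⊤ : Submodule A X).mkQ x)
      choose l hl using Ideal.Quotient.mk_surjective (I := M)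
      refine ⟨Finsupp.onFinset r.support (fun i => if r i = 0 then 0 else l (r i))
        (fun i hi => by simp at hi; simpa using hi.1), ?_⟩
      rw [← b.linearCombination_repr ((M • ⊤ : Submodule A X).mkQ x),
        Finsupp.linearCombination_apply, Finsupp.onFinset_sum _ (by simp), Finsupp.sum]
      refine Finset.sum_congr rfl fun i hi => ?_
      rw [if_neg (Finsupp.mem_support_iff.1 hi), hl]
    rw [← hmk, Submodule.mkQ_apply, Submodule.mkQ_apply, Submodule.Quotient.eq] at hc
    exact ⟨(c, ⟨_, hc⟩), by simp [Φ]⟩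
  have hex' := lTensor_exact P hex hsurj
  have h1 : Φ.lTensor P ((LinearMap.inr A (ι →₀ A) _).lTensor P ξ) = 0 := by
    rw [← LinearMap.comp_apply, ← LinearMap.lTensor_comp, LinearMap.coprod_inr, hξ]
  obtain ⟨η, hη⟩ := (hex' _).1 h1
  have hη₁ : Ψ₁.lTensor P η = 0 := by
    have := congrArg ((LinearMap.fst A (ι →₀ A) (M • ⊤ : Submodule A X)).lTensor P) hη
    rw [← LinearMap.comp_apply, ← LinearMap.lTensor_comp, LinearMap.fst_prod,
      ← LinearMap.comp_apply, ← LinearMap.lTensor_comp, LinearMap.fst_comp_inr] at this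
    simpa using this
  have hη₂ : (-Ψ₂).lTensor P η = ξ := by
    have := congrArg ((LinearMap.snd A (ι →₀ A) (M • ⊤ : Submodule A X)).lTensor P) hη
    rw [← LinearMap.comp_apply, ← LinearMap.lTensor_comp, LinearMap.snd_prod,
      ← LinearMap.comp_apply, ← LinearMap.lTensor_comp, LinearMap.snd_comp_inr] at this
    simpa using this
  let h : P ⊗[A] (ι →₀ M) →ₗ[A] (ι →₀ (M • ⊤ : Submodule A P)) :=
    Finsupp.mapRange.linearMap μ ∘ₗ (TensorProduct.finsuppRight A A P M ι).toLinearMap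
  have hh : Finsupp.mapRange.linearMap (M • ⊤ : Submodule A P).subtype ∘ₗ h =
      Finsupp.mapRange.linearMap (TensorProduct.rid A P).toLinearMap ∘ₗ
        (TensorProduct.finsuppRight A A P A ι).toLinearMap ∘ₗ Ψ₁.lTensor P := by
    refine TensorProduct.ext' fun p x => ?_
    induction x using Finsupp.induction_linear with
    | zero => simp
    | add x y hx hy => rw [TensorProduct.tmul_add, map_add, map_add, hx, hy]
    | single i m => simp [h, Ψ₁, μ]
  have hhη : h η = 0 := by
    have h2 := LinearMap.congr_fun hh η
    simp only [LinearMap.comp_apply, hη₁, map_zero] at h2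
    refine Finsupp.mapRange_injective _ (map_zero _) Subtype.val_injective (h2.trans ?_)
    simp
  have hfh : f ∘ₗ (-Ψ₂).lTensor P = -((Finsupp.lsum ℕ fun i => g (v i)) ∘ₗ h) := by
    refine TensorProduct.ext' fun p x => ?_
    induction x using Finsupp.induction_linear with
    | zero => simp
    | add x y hx hy => rw [TensorProduct.tmul_add, map_add, map_add, hx, hy]
    | single i m =>
      simp only [LinearMap.comp_apply, LinearMap.lTensor_tmul, LinearMap.neg_apply,
        TensorProduct.tmul_neg, map_neg]
      simp [h, Ψ₂, μ, mulV, ← hg (v i) p m m.2]; rfl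
  rw [← hη₂, ← LinearMap.comp_apply, hfh, LinearMap.neg_apply,
    LinearMap.comp_apply, hhη, map_zero, neg_zero]

/-- Over the field `A/M` the relation forces the classes of `z` and `1` in `C/MC` to be
proportional: contract one tensor factor with a functional that does not vanish at `1`. -/
theorem exists_sub_algebraMap_mem_smul_top {A C : Type*} [CommRing A] [CommRing C] [Algebra A C]
    (M : Ideal A) [M.IsMaximal] {z : C} (hz : z ⊗ₜ[A] (1 : C) = 1 ⊗ₜ[A] z) :
    ∃ r : A, z - algebraMap A C r ∈ (M • ⊤ : Submodule A C) := by
  let _ := Ideal.Quotient.field M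
  let π := (M • ⊤ : Submodule A C).mkQ
  by_cases h1 : π 1 = 0
  · refine ⟨0, ?_⟩
    have h2 : (1 : C) ∈ (M • ⊤ : Submodule A C) := by
      rwa [Submodule.mkQ_apply, Submodule.Quotient.mk_eq_zero] at h1
    rw [Ideal.smul_top_eq_map, Submodule.restrictScalars_mem] at h2 ⊢
    rw [(Ideal.eq_top_iff_one _).2 h2]
    trivial
  · obtain ⟨g, hg⟩ := not_forall.1 fun h => h1 ((Module.forall_dual_apply_eq_zero_iff (A ⧸ M) _).1 h)
    have key := congrArg (TensorProduct.lift ((LinearMap.lsmul (A ⧸ M)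
      (C ⧸ (M • ⊤ : Submodule A C))).restrictScalars₁₂ A A |>.compl₁₂
        (g.restrictScalars A ∘ₗ π) π)) hz
    have key' : g (π z) • π 1 = g (π 1) • π z := key
    obtain ⟨r, hr⟩ := Ideal.Quotient.mk_surjective ((g (π 1))⁻¹ * g (π z))
    refine ⟨r, ?_⟩
    rw [← Submodule.Quotient.mk_eq_zero, ← Submodule.mkQ_apply, map_sub, sub_eq_zero,
      Algebra.algebraMap_eq_smul_one, map_smul]
    change π z = Ideal.Quotient.mk M r • π 1
    rw [hr, mul_smul, key', inv_smul_smul₀ hg]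

/-- Division by `a` is a map `δ : MC → C'`, and `p ⊗ u ↦ p ⊗ δ u` is defined on `C ⊗ MC` only,
whereas `h` lives in `C ⊗ C`. The kernel lemma above bridges the gap, since `p ⊗ δ(mv) = (m/a)p ⊗ v
= δ(mp) ⊗ v` over `A'`. -/
theorem tmul_eq_tmul_of_smul_tmul_eq {A C A' C' : Type*} [CommRing A] [CommRing C] [Algebra A C]
    [CommRing A'] [CommRing C'] [Algebra A A'] [Algebra A' C'] [Algebra A C'] [Algebra C C']
    [IsScalarTower A A' C'] [IsScalarTower A C C'] (M : Ideal A) [M.IsMaximal] (a : A)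
    (ha : ∀ x y : C', algebraMap A C' a * x = algebraMap A C' a * y → x = y)
    (hM : ∀ m ∈ M, ∃ x : A', algebraMap A A' m = algebraMap A A' a * x)
    {w : C'} {u : C} (hu : u ∈ (M • ⊤ : Submodule A C))
    (huw : algebraMap C C' u = algebraMap A C' a * w)
    (h : u ⊗ₜ[A] (1 : C) = 1 ⊗ₜ[A] u) : w ⊗ₜ[A'] (1 : C') = 1 ⊗ₜ[A'] w := by
  have hdiv : ∀ u ∈ (M • ⊤ : Submodule A C), ∃ c : C', algebraMap C C' u = algebraMap A C' a * c := by
    intro u hu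
    induction hu using Submodule.smul_induction_on' with
    | smul m hm c _ =>
      obtain ⟨x, hx⟩ := hM m hm
      refine ⟨algebraMap A' C' x * algebraMap C C' c, ?_⟩
      rw [Algebra.smul_def, map_mul, ← IsScalarTower.algebraMap_apply,
        IsScalarTower.algebraMap_apply A A' C' m, hx, map_mul, ← IsScalarTower.algebraMap_apply,
        mul_assoc]
    | add x _ y _ hx hy =>
      obtain ⟨c, hc⟩ := hx
      obtain ⟨d, hd⟩ := hy
      exact ⟨c + d, by rw [map_add, hc, hd, mul_add]⟩
  choose! q hq using hM
  choose! d hd using hdiv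
  let δ : (M • ⊤ : Submodule A C) →ₗ[A] C' :=
    { toFun u := d u
      map_add' u v := ha _ _ <| by
        rw [← hd _ (u + v).2, mul_add, ← hd _ u.2, ← hd _ v.2, ← map_add]; rfl
      map_smul' c u := ha _ _ <| by
        rw [← hd _ (c • u).2, RingHom.id_apply, mul_smul_comm, ← hd _ u.2]
        exact map_smul (IsScalarTower.toAlgHom A C C') c (u : C) }
  have hδ (u) : algebraMap A C' a * δ u = algebraMap C C' u := (hd _ u.2).symm
  let T := TensorProduct.mk A' C' C'
  let ι : C →ₗ[A] C' := (IsScalarTower.toAlgHom A C C').toLinearMap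
  let f : C ⊗[A] (M • ⊤ : Submodule A C) →ₗ[A] C' ⊗[A'] C' :=
    TensorProduct.lift ((T.restrictScalars₁₂ A A).compl₁₂ ι δ)
  have hf (p : C) (u : (M • ⊤ : Submodule A C)) : f (p ⊗ₜ u) = algebraMap C C' p ⊗ₜ δ u := rfl
  have hδm (m : A) (hm : m ∈ M) (v : C) :
      δ ⟨m • v, Submodule.smul_mem_smul hm Submodule.mem_top⟩ = q m • algebraMap C C' v := by
    apply ha
    rw [hδ, Algebra.smul_def (q m), ← mul_assoc, IsScalarTower.algebraMap_apply A A' C' a, ← map_mul,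
      ← hq m hm, ← IsScalarTower.algebraMap_apply, ← Algebra.smul_def]
    exact map_smul (IsScalarTower.toAlgHom A C C') m v
  -- A lift of `u ⊗ 1` to `C ⊗ MC`: move the scalar across, `mc ⊗ 1 = c ⊗ m·1`.
  have hex : ∀ u (hu : u ∈ (M • ⊤ : Submodule A C)), ∃ ξ : C ⊗[A] (M • ⊤ : Submodule A C),
      (M • ⊤ : Submodule A C).subtype.lTensor C ξ = u ⊗ₜ 1 ∧ f ξ = δ ⟨u, hu⟩ ⊗ₜ 1 := by
    intro u hu
    induction hu using Submodule.smul_induction_on' with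
    | smul m hm c _ =>
      refine ⟨c ⊗ₜ ⟨m • 1, Submodule.smul_mem_smul hm Submodule.mem_top⟩, ?_, ?_⟩
      · rw [LinearMap.lTensor_tmul, Submodule.subtype_apply, TensorProduct.smul_tmul]
      · rw [hf, hδm m hm, hδm m hm, map_one, TensorProduct.smul_tmul]
    | add x hx' y hy' hx hy =>
      obtain ⟨ξ, h1, h2⟩ := hx
      obtain ⟨η, h3, h4⟩ := hy
      refine ⟨ξ + η, by rw [map_add, h1, h3, TensorProduct.add_tmul], ?_⟩
      rw [map_add, h2, h4, ← TensorProduct.add_tmul, ← map_add]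
      rfl
  obtain ⟨ξ, h1, h2⟩ := hex u hu
  have hw : δ ⟨u, hu⟩ = w := ha _ _ (by rw [hδ, huw])
  have := lTensor_smul_top_apply_eq_zero M f (fun v => ⟨(T.flip (algebraMap C C' v)).restrictScalars A ∘ₗ δ,
    fun p m hm => by
      rw [hf, hδm m hm, LinearMap.comp_apply, hδm m hm, ← TensorProduct.smul_tmul]
      rfl⟩) (ξ - 1 ⊗ₜ ⟨u, hu⟩) (by
        rw [map_sub, h1, h, LinearMap.lTensor_tmul, Submodule.subtype_apply, sub_self])
  rwa [map_sub, h2, hf, hw, map_one, sub_eq_zero] at this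

/-! ### Arf rings inside a fixed overring, and their blow-ups -/

/-- The Arf conditions on `A`, phrased inside an overring `K` of `A` in place of the total ring of
fractions, together with the existence of enough elements of `A` that are invertible in `K`. -/
structure IsArfIn (A K : Type*) [CommRing A] [CommRing K] [Algebra A K] : Prop where
  injective : Function.Injective (algebraMap A K)
  exists_isIntegral_div : ∀ I : Ideal A, (∃ s ∈ I, IsUnit (algebraMap A K s)) →
    I.IsIntegrallyClosedIdeal → ∃ a ∈ I, IsUnit (algebraMap A K a) ∧
      ∀ x ∈ I, ∃ t : K, IsIntegral A t ∧ algebraMap A K x = algebraMap A K a * t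
  exists_eq_mul_mul : ∀ (x y z : A) (t t' : K), IsUnit (algebraMap A K x) → IsIntegral A t →
    IsIntegral A t' → algebraMap A K y = algebraMap A K x * t →
    algebraMap A K z = algebraMap A K x * t' →
    ∃ r, algebraMap A K r = algebraMap A K x * (t * t')
  exists_isUnit_mem : ∀ M : Ideal A, M.IsMaximal → ∃ s ∈ M, IsUnit (algebraMap A K s)

section

variable {A K : Type*} [CommRing A] [CommRing K] [Algebra A K]

/-- Scaling the roots of a monic equation of `t` by `a` gives a monic equation for `w` with lower
coefficients in `I`, so a power of `w` lies in `I`. -/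
theorem Ideal.IsRadical.mem_of_eq_mul_isIntegral (hinj : Function.Injective (algebraMap A K))
    {I : Ideal A} (hI : I.IsRadical) {a w : A} (ha : a ∈ I) {t : K} (ht : IsIntegral A t)
    (hw : algebraMap A K w = algebraMap A K a * t) : w ∈ I := by
  obtain ⟨p, hp, hpt⟩ := ht
  have h := Polynomial.scaleRoots_aeval_eq_zero (r := a) (p := p) (a := t) hpt
  rw [← hw, Polynomial.aeval_algebraMap_apply] at h
  have hroot : (p.scaleRoots a).IsRoot w :=
    hinj (by simpa using h)
  exact hI ⟨_, (Polynomial.scaleRoots.isWeaklyEisensteinAt p ha).pow_natDegree_le_of_root_of_monic_mem hroot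
    ((Polynomial.monic_scaleRoots_iff a).2 hp) _ le_rfl⟩

theorem Ideal.IsRadical.isIntegrallyClosedIdeal {I : Ideal A} (hI : I.IsRadical) :
    I.IsIntegrallyClosedIdeal := by
  rintro x ⟨n, a, hn, ha, h⟩
  refine hI ⟨n, ?_⟩
  rw [eq_neg_of_add_eq_zero_left h]
  refine I.neg_mem (Ideal.sum_mem _ fun i hi => I.mul_mem_right _ ?_)
  exact Ideal.pow_le_self (by simp at hi; omega) (ha i hi)

namespace IsArfIn

variable (h : IsArfIn A K) {M : Ideal A} {a : A}

/-- The ring `a⁻¹ M`. -/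
def blowup (h : IsArfIn A K) (hM : M.IsRadical) (ha : a ∈ M) (hu : IsUnit (algebraMap A K a))
    (hint : ∀ x ∈ M, ∃ t : K, IsIntegral A t ∧ algebraMap A K x = algebraMap A K a * t) :
    Subalgebra A K where
  carrier := {t | ∃ m ∈ M, algebraMap A K m = algebraMap A K a * t}
  add_mem' := by
    rintro t t' ⟨m, hm, e⟩ ⟨m', hm', e'⟩
    exact ⟨m + m', M.add_mem hm hm', by rw [map_add, e, e', mul_add]⟩
  algebraMap_mem' r := ⟨a * r, M.mul_mem_right _ ha, map_mul _ _ _⟩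
  mul_mem' := by
    rintro t t' ⟨m, hm, e⟩ ⟨m', hm', e'⟩
    obtain ⟨t₁, ht, e₁⟩ := hint m hm
    obtain ⟨t₂, ht', e₂⟩ := hint m' hm'
    obtain rfl := hu.mul_left_cancel (e.symm.trans e₁)
    obtain rfl := hu.mul_left_cancel (e'.symm.trans e₂)
    -- The second Arf condition puts `a t t'` in `A`; integrality of `t t'` then puts it in the
    -- radical ideal `M`.
    obtain ⟨r, hr⟩ := h.exists_eq_mul_mul a m m' t t' hu ht ht' e e'
    exact ⟨r, hM.mem_of_eq_mul_isIntegral h.injective ha (ht.mul ht') hr, hr⟩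

variable (hM : M.IsRadical) (ha : a ∈ M) (hu : IsUnit (algebraMap A K a))
    (hint : ∀ x ∈ M, ∃ t : K, IsIntegral A t ∧ algebraMap A K x = algebraMap A K a * t)

theorem isIntegral_blowup : Algebra.IsIntegral A (h.blowup hM ha hu hint) := by
  refine ⟨fun ⟨t, m, hm, e⟩ => ?_⟩
  obtain ⟨t₁, ht, e₁⟩ := hint m hm
  obtain rfl := hu.mul_left_cancel (e.symm.trans e₁)
  exact (isIntegral_algHom_iff (h.blowup hM ha hu hint).val Subtype.val_injective).1 ht

/-- An integrally closed ideal `I` of `a⁻¹M` corresponds to the ideal `J = aI ⊆ M` of `A`, which is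
again integrally closed; a generator up to integral factors of `J` is `a` times one of `I`. Products
are treated by multiplying through by `a`. -/
theorem isArfIn_blowup : IsArfIn (h.blowup hM ha hu hint) K := by
  set A' := h.blowup hM ha hu hint
  have := h.isIntegral_blowup hM ha hu hint
  refine ⟨Subtype.val_injective, ?_, ?_, ?_⟩
  · rintro I ⟨s, hs, hsu⟩ hI
    let J : Ideal A :=
      { carrier := {x | ∃ y ∈ I, algebraMap A A' x = algebraMap A A' a * y}
        zero_mem' := ⟨0, I.zero_mem, by simp⟩
        add_mem' := by
          rintro x x' ⟨y, hy, e⟩ ⟨y', hy', e'⟩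
          exact ⟨y + y', I.add_mem hy hy', by rw [map_add, e, e', mul_add]⟩
        smul_mem' := by
          rintro c x ⟨y, hy, e⟩
          exact ⟨algebraMap A A' c * y, I.mul_mem_left _ hy, by
            rw [smul_eq_mul, map_mul, e, mul_left_comm]⟩ }
    have hAK (x : A) (y : A') : algebraMap A A' x = algebraMap A A' a * y ↔
        algebraMap A K x = algebraMap A K a * y := Subtype.ext_iff
    have hJ (y : A') (hy : y ∈ I) :
        ∃ x ∈ J, algebraMap A K x = algebraMap A K a * (y : K) := by
      obtain ⟨m, hm, e⟩ := y.2
      exact ⟨m, ⟨y, hy, (hAK _ _).2 e⟩, e⟩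
    have hJM : J ≤ M := by
      rintro x ⟨y, hy, e⟩
      obtain ⟨m, hm, e'⟩ := y.2
      rw [hAK, ← e'] at e
      rwa [h.injective e]
    have hJpow (i : ℕ) (x : A) (hx : x ∈ J ^ i) :
        ∃ y ∈ I ^ i, algebraMap A A' x = algebraMap A A' a ^ i * y := by
      have hle : J.map (algebraMap A A') ≤ Ideal.span {algebraMap A A' a} * I := by
        rw [Ideal.map_le_iff_le_comap]
        rintro x ⟨y, hy, e⟩
        exact Ideal.mem_span_singleton_mul.2 ⟨y, hy, e.symm⟩
      have h1 := Ideal.pow_right_mono hle i (Ideal.map_pow (algebraMap A A') J i ▸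
        Ideal.mem_map_of_mem _ hx)
      rw [mul_pow, Ideal.span_singleton_pow] at h1
      obtain ⟨y, hy, e⟩ := Ideal.mem_span_singleton_mul.1 h1
      exact ⟨y, hy, e.symm⟩
    have hJclosed : J.IsIntegrallyClosedIdeal := by
      rintro w ⟨n, c, hn, hc, e⟩
      -- Membership in `M` allows `w` to be divided by `a`; the equation of `w` over `J` divided by
      -- `a ^ n` is one of `w/a` over `I`.
      have hwM : w ∈ M := by
        refine hM.isIntegrallyClosedIdeal w ⟨n, c, hn, fun i hi => ?_, e⟩
        exact Ideal.pow_right_mono hJM i (hc i hi)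
      choose! d hd hcd using hJpow
      obtain ⟨t, ht, et⟩ := hint w hwM
      let w' : A' := ⟨t, w, hwM, et⟩
      have hw' : algebraMap A A' w = algebraMap A A' a * w' := (hAK _ _).2 et
      refine ⟨w', hI w' ⟨n, fun i => d i (c i), hn, fun i hi => hd i _ (hc i hi), ?_⟩, hw'⟩
      have hu' : IsUnit ((algebraMap A K a) ^ n) := hu.pow n
      have e' := congrArg (algebraMap A A') e
      apply Subtype.val_injective
      apply hu'.mul_left_cancel
      have : algebraMap A A' a ^ n * (w' ^ n + ∑ i ∈ Finset.Icc 1 n, d i (c i) * w' ^ (n - i)) =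
          algebraMap A A' a ^ n * 0 := by
        rw [mul_zero, ← map_zero (algebraMap A A'), ← e, map_add, map_pow, hw', mul_add, mul_pow,
          map_sum, Finset.mul_sum]
        congr 1
        refine Finset.sum_congr rfl fun i hi => ?_
        rw [map_mul, map_pow, hw', hcd i _ (hc i hi), mul_pow,
          ← Nat.add_sub_of_le (Finset.mem_Icc.1 hi).2, pow_add]
        simp only [add_tsub_cancel_left]
        ring
      exact congrArg Subtype.val this
    obtain ⟨x₀, hx₀, ex₀⟩ := hJ s hs
    obtain ⟨b, ⟨b', hb', eb⟩, hbu, hb⟩ := h.exists_isIntegral_div J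
      ⟨x₀, hx₀, by rw [ex₀]; exact hu.mul hsu⟩ hJclosed
    rw [hAK] at eb
    refine ⟨b', hb', isUnit_of_mul_isUnit_right (eb ▸ hbu), fun y hy => ?_⟩
    obtain ⟨x, hx, ex⟩ := hJ y hy
    obtain ⟨t, ht, et⟩ := hb x hx
    refine ⟨t, ht.tower_top, hu.mul_left_cancel ?_⟩
    rw [← mul_assoc]
    change algebraMap A K a * (y : K) = algebraMap A K a * (b' : K) * t
    rw [← ex, et, eb]
  · rintro ⟨x, x₁, hx₁, ex⟩ ⟨y, y₁, hy₁, ey⟩ ⟨z, z₁, hz₁, ez⟩ t t' hxu ht ht' e e'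
    change y = x * t at e
    change z = x * t' at e'
    change IsUnit x at hxu
    obtain ⟨r, hr⟩ := h.exists_eq_mul_mul x₁ y₁ z₁ t t' (ex ▸ hu.mul hxu)
      (isIntegral_trans t ht) (isIntegral_trans t' ht') (by rw [ey, e, ex, mul_assoc])
      (by rw [ez, e', ex, mul_assoc])
    have hx : IsIntegral A x :=
      (Algebra.IsIntegral.isIntegral (⟨x, x₁, hx₁, ex⟩ : A')).map A'.val
    rw [ex, mul_assoc] at hr
    exact ⟨⟨x * (t * t'), r, hM.mem_of_eq_mul_isIntegral h.injective ha
      (hx.mul ((isIntegral_trans t ht).mul (isIntegral_trans t' ht'))) hr, hr⟩, rfl⟩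
  · intro N hN
    obtain ⟨s, hs, hsu⟩ := h.exists_isUnit_mem (N.comap (algebraMap A A'))
      (Ideal.isMaximal_comap_of_isIntegral_of_isMaximal N)
    exact ⟨algebraMap A A' s, hs, hsu⟩

end IsArfIn

end

/-! ### Descent on the length of `C/A` -/

theorem exists_isMaximal_smul_top_ne_top {A Q : Type*} [CommRing A] [AddCommGroup Q] [Module A Q]
    [Module.Finite A Q] [Nontrivial Q] :
    ∃ M : Ideal A, M.IsMaximal ∧ (M • ⊤ : Submodule A Q) ≠ ⊤ := by
  obtain ⟨M, hM, hle⟩ := Ideal.exists_le_maximal (Module.annihilator A Q) (by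
    rw [Ne, Ideal.eq_top_iff_one, Module.mem_annihilator]
    intro h
    obtain ⟨x, hx⟩ := exists_ne (0 : Q)
    exact hx (by simpa using h x))
  refine ⟨M, hM, fun htop => hM.ne_top ?_⟩
  obtain ⟨r, hr, hr'⟩ := Submodule.exists_sub_one_mem_and_smul_eq_zero_of_fg_of_le_smul M ⊤
    Module.Finite.fg_top htop.ge
  have hrM : r ∈ M := hle (Module.mem_annihilator.2 fun x => hr' x trivial)
  rw [Ideal.eq_top_iff_one]
  simpa using M.sub_mem hrM hr

section

variable {A K : Type*} [CommRing A] [CommRing K] [Algebra A K]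

theorem Subalgebra.toSubmodule_adjoin_coe (A' : Subalgebra A K) (C : Subalgebra A K) :
    (Algebra.adjoin A' (C : Set K)).toSubmodule = Submodule.span A' (C : Set K) := by
  rw [Algebra.adjoin_eq_span]
  congr 1
  exact congrArg _ (Submonoid.closure_eq C.toSubmonoid)

theorem Subalgebra.finite_adjoin_coe (A' : Subalgebra A K) (C : Subalgebra A K)
    [Module.Finite A C] : Module.Finite A' (Algebra.adjoin A' (C : Set K)) := by
  obtain ⟨S, hS⟩ := (Module.Finite.iff_fg (N := C.toSubmodule)).1 (inferInstanceAs (Module.Finite A C))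
  refine (Module.Finite.iff_fg (N := (Algebra.adjoin A' (C : Set K)).toSubmodule)).2 ?_
  rw [toSubmodule_adjoin_coe]
  refine ⟨S, le_antisymm (Submodule.span_mono ?_) (Submodule.span_le.2 ?_)⟩
  · intro x hx
    exact (hS ▸ Submodule.subset_span hx : x ∈ C.toSubmodule)
  · intro x hx
    have : x ∈ Submodule.span A (S : Set K) := hS ▸ hx
    exact Submodule.span_le_restrictScalars A A' _ this

namespace IsArfIn

variable (h : IsArfIn A K) {M : Ideal A} {a : A} (hM : M.IsRadical) (ha : a ∈ M)
  (hu : IsUnit (algebraMap A K a))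
  (hint : ∀ x ∈ M, ∃ t : K, IsIntegral A t ∧ algebraMap A K x = algebraMap A K a * t)

theorem exists_smul_top_of_mem_adjoin_blowup (C : Subalgebra A K) {c : K}
    (hc : c ∈ Algebra.adjoin (h.blowup hM ha hu hint) (C : Set K)) :
    ∃ u ∈ (M • ⊤ : Submodule A C), (u : K) = algebraMap A K a * c := by
  -- The extra factor `t` lets the induction over the span absorb scalars from the blow-up; `a t ∈
  -- M` is used on generators.
  suffices ∀ t ∈ h.blowup hM ha hu hint,
      ∃ u ∈ (M • ⊤ : Submodule A C), (u : K) = algebraMap A K a * (t * c) by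
    simpa using this 1 (one_mem _)
  rw [← Subalgebra.mem_toSubmodule, Subalgebra.toSubmodule_adjoin_coe] at hc
  induction hc using Submodule.span_induction with
  | mem x hx =>
    rintro t ⟨m, hm, e⟩
    refine ⟨m • ⟨x, hx⟩, Submodule.smul_mem_smul hm trivial, ?_⟩
    rw [← mul_assoc, ← e]
    exact Algebra.smul_def _ _
  | zero => exact fun _ _ => ⟨0, zero_mem _, by simp⟩
  | add x y _ _ hx hy =>
    intro t ht
    obtain ⟨u, hu, e⟩ := hx t ht
    obtain ⟨v, hv, e'⟩ := hy t ht
    exact ⟨u + v, add_mem hu hv, by rw [Subalgebra.coe_add, e, e']; ring⟩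
  | smul s x _ hx =>
    intro t ht
    obtain ⟨u, hu, e⟩ := hx (t * s) (mul_mem ht s.2)
    exact ⟨u, hu, by rw [e, Subalgebra.smul_def, smul_eq_mul, mul_assoc]⟩

/-- Multiplication by `a` sends `C'` into `MC`, hence into the proper submodule `M(C/A)` of `C/A`.
Its kernel is exactly `A'`: if `ac ∈ A` with `c` integral, then `ac ∈ M`. -/
theorem length_adjoin_blowup_lt (C : Subalgebra A K) [Module.Finite A C]
    (hlen : Module.length A (C ⧸ (1 : Submodule A C)) ≠ ⊤)
    (hMC : (M • ⊤ : Submodule A (C ⧸ (1 : Submodule A C))) ≠ ⊤) :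
    Module.length (h.blowup hM ha hu hint)
      (Algebra.adjoin (h.blowup hM ha hu hint) (C : Set K) ⧸
        (1 : Submodule (h.blowup hM ha hu hint)
          (Algebra.adjoin (h.blowup hM ha hu hint) (C : Set K)))) <
      Module.length A (C ⧸ (1 : Submodule A C)) := by
  set A' := h.blowup hM ha hu hint
  set C' := Algebra.adjoin A' (C : Set K)
  have := h.isIntegral_blowup hM ha hu hint
  have := Subalgebra.finite_adjoin_coe A' C
  obtain ⟨_, _⟩ := isFiniteLength_iff_isNoetherian_isArtinian.1 (Module.length_ne_top_iff.1 hlen)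
  refine lt_of_le_of_lt ?_ (Submodule.length_lt hMC)
  have h1 := Submodule.length_le_length_restrictScalars A
    (⊤ : Submodule A' (C' ⧸ (1 : Submodule A' C')))
  rw [Submodule.restrictScalars_top, Module.length_top, Module.length_top] at h1
  refine h1.trans ?_
  have hC' (c : C') := h.exists_smul_top_of_mem_adjoin_blowup hM ha hu hint C c.2
  choose ψ hψM hψ using hC'
  let ψ' : C' →ₗ[A] C :=
    { toFun := ψ
      map_add' x y := Subtype.val_injective <| by
        rw [Subalgebra.coe_add, hψ, hψ, hψ, Subalgebra.coe_add, mul_add]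
      map_smul' r x := Subtype.val_injective <| by
        rw [RingHom.id_apply, Subalgebra.coe_smul, hψ, hψ, ← mul_smul_comm]; rfl }
  let φ : C' →ₗ[A] (M • ⊤ : Submodule A (C ⧸ (1 : Submodule A C))) :=
    ((1 : Submodule A C).mkQ ∘ₗ ψ').codRestrict _ fun c => by
      have := Submodule.mem_map_of_mem (f := (1 : Submodule A C).mkQ) (hψM c)
      rw [Submodule.map_smul''] at this
      exact Submodule.smul_mono le_rfl le_top this
  have hker : ((1 : Submodule A' C').restrictScalars A) = LinearMap.ker φ := by
    ext c
    have hφ : c ∈ LinearMap.ker φ ↔ ψ c ∈ (1 : Submodule A C) := by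
      rw [LinearMap.ker_codRestrict, LinearMap.mem_ker, LinearMap.comp_apply, Submodule.mkQ_apply,
        Submodule.Quotient.mk_eq_zero]
      rfl
    rw [hφ, Submodule.restrictScalars_mem, Submodule.mem_one, Submodule.mem_one]
    constructor
    · rintro ⟨⟨t, m, hm, e⟩, rfl⟩
      exact ⟨m, Subtype.val_injective (e.trans (hψ (algebraMap A' C' ⟨t, m, hm, e⟩)).symm)⟩
    · rintro ⟨r, hr⟩
      have hr' : algebraMap A K r = algebraMap A K a * c := (congrArg Subtype.val hr).trans (hψ c)
      have hc : IsIntegral A (c : K) :=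
        isIntegral_trans (A := A') _ ((Algebra.IsIntegral.isIntegral (R := A') c).map C'.val)
      exact ⟨⟨c, r, hM.mem_of_eq_mul_isIntegral h.injective ha hc hr', hr'⟩, rfl⟩
  refine Module.length_le_of_injective ((((1 : Submodule A' C').restrictScalars A).liftQ φ
    hker.le) ∘ₗ (Submodule.Quotient.restrictScalarsEquiv A (1 : Submodule A' C')).symm.toLinearMap) ?_
  rw [LinearMap.coe_comp]
  exact (LinearMap.ker_eq_bot.1 (Submodule.ker_liftQ_eq_bot _ _ _ hker.ge)).comp
    (LinearEquiv.injective _)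

end IsArfIn
end

/-- The induction replaces `A` by a subalgebra of `K`, hence the common universe. No Noetherian
hypothesis has to be propagated to blow-ups: finiteness of `C` and of the length is enough. -/
theorem IsArfIn.mem_range_of_tmul_eq {A K : Type u} [CommRing A] [CommRing K] [Algebra A K]
    (h : IsArfIn A K) (C : Subalgebra A K) [Module.Finite A C]
    (hlen : Module.length A (C ⧸ (1 : Submodule A C)) ≠ ⊤) {z : C}
    (hz : z ⊗ₜ[A] (1 : C) = 1 ⊗ₜ[A] z) : z ∈ (algebraMap A C).range := by
  induction hn : Module.length A (C ⧸ (1 : Submodule A C)) using WellFoundedLT.induction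
    generalizing A with
  | ind n ih =>
  subst hn
  by_cases htop : Nontrivial (C ⧸ (1 : Submodule A C))
  · obtain ⟨M, hMmax, hMC⟩ :=
      exists_isMaximal_smul_top_ne_top (A := A) (Q := C ⧸ (1 : Submodule A C))
    have hM : M.IsRadical := hMmax.isPrime.isRadical
    obtain ⟨a, ha, hu, hint⟩ := h.exists_isIntegral_div M (h.exists_isUnit_mem M hMmax)
      hM.isIntegrallyClosedIdeal
    have hlt := h.length_adjoin_blowup_lt hM ha hu hint C hlen hMC
    set A' := h.blowup hM ha hu hint with hA'
    set C' := Algebra.adjoin A' (C : Set K) with hC'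
    have : Module.Finite A' C' := Subalgebra.finite_adjoin_coe A' C
    obtain ⟨r, hr⟩ := exists_sub_algebraMap_mem_smul_top M hz
    let _ : Algebra C C' :=
      (C.val.toRingHom.codRestrict C' fun c => Algebra.subset_adjoin c.2).toAlgebra
    have : IsScalarTower A C C' := IsScalarTower.of_algebraMap_eq fun _ => rfl
    have hex : ∃ w : C', algebraMap C C' (z - algebraMap A C r) = algebraMap A C' a * w := by
      obtain ⟨u, hu', e⟩ : ∃ w : K, w ∈ C' ∧
          ((z - algebraMap A C r : C) : K) = algebraMap A K a * w := by
        generalize z - algebraMap A C r = v at hr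
        induction hr using Submodule.smul_induction_on' with
        | smul m hm c _ =>
          obtain ⟨t, ht, e⟩ := hint m hm
          refine ⟨t * c, mul_mem (C'.algebraMap_mem ⟨t, m, hm, e⟩) (Algebra.subset_adjoin c.2), ?_⟩
          rw [← mul_assoc, ← e, Subalgebra.coe_smul, Algebra.smul_def]
        | add x _ y _ hx hy =>
          obtain ⟨v, hv, e⟩ := hx
          obtain ⟨v', hv', e'⟩ := hy
          exact ⟨v + v', add_mem hv hv', by rw [Subalgebra.coe_add, e, e', mul_add]⟩
      exact ⟨⟨u, hu'⟩, Subtype.val_injective e⟩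
    obtain ⟨w, hw⟩ := hex
    have hwt := tmul_eq_tmul_of_smul_tmul_eq (A' := A') M a (w := w)
      (fun x y hxy => Subtype.val_injective (hu.mul_left_cancel (congrArg Subtype.val hxy)))
      (fun m hm => by
        obtain ⟨t, ht, e⟩ := hint m hm
        exact ⟨⟨t, m, hm, e⟩, Subtype.val_injective e⟩) hr hw (by
          rw [TensorProduct.sub_tmul, TensorProduct.tmul_sub, hz, Algebra.algebraMap_eq_smul_one,
            TensorProduct.smul_tmul])
    obtain ⟨t, ht⟩ := ih _ hlt (h.isArfIn_blowup hM ha hu hint) C' hlt.ne_top hwt rfl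
    obtain ⟨m, hm, e⟩ := t.2
    refine ⟨r + m, Subtype.val_injective ?_⟩
    have hw' : ((z - algebraMap A C r : C) : K) = algebraMap A K a * w := congrArg Subtype.val hw
    have ht' : (t : K) = w := congrArg Subtype.val ht
    rw [← ht', ← e, Subalgebra.coe_sub] at hw'
    rw [map_add, Subalgebra.coe_add]
    exact (sub_eq_iff_eq_add'.1 hw').symm
  · rw [not_nontrivial_iff_subsingleton, Submodule.Quotient.subsingleton_iff] at htop
    exact Submodule.mem_one.1 (htop ▸ Submodule.mem_top : z ∈ (1 : Submodule A C))

/-! ### Regular elements and finite length in dimension one -/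

section

variable {A : Type*} [CommRing A]

theorem isMaximal_of_ringKrullDim_eq_one
    (hdim : ∀ (M : Ideal A) [M.IsMaximal], ringKrullDim (Localization.AtPrime M) = 1)
    {s : A} (hs : s ∈ A⁰) {P : Ideal A} [hP : P.IsPrime] (hsP : s ∈ P) : P.IsMaximal := by
  obtain ⟨M, hM, hle⟩ := P.exists_le_maximal hP.ne_top
  rcases hle.eq_or_lt with rfl | hlt
  · exact hM
  · have h1 := IsLocalization.AtPrime.ringKrullDim_eq_height M (Localization.AtPrime M)
    rw [hdim M] at h1
    have h2 : M.height = 1 := by exact_mod_cast h1.symm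
    have h3 := Ideal.height_le_iff.1 h2.le P hP hlt
    rw [Nat.cast_one, Order.lt_one_iff, Ideal.height_eq_zero_iff] at h3
    exact absurd hs (notMem_nonZeroDivisors_of_mem_mem_minimalPrimes hsP h3)

/-- If `M` consists of zero divisors, prime avoidance gives `M = ann x`. Then `x` is killed by a
regular element of `A_M`, so `x` vanishes there and some `t ∉ M` kills `x`, a contradiction. -/
theorem exists_mem_nonZeroDivisors_of_localRingDepth_ne_zero [IsNoetherianRing A] (M : Ideal A)
    [hM : M.IsMaximal] (hdepth : localRingDepth (Localization.AtPrime M) ≠ 0) :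
    ∃ s ∈ M, s ∈ A⁰ := by
  obtain ⟨r, hr, hreg⟩ : ∃ r ∈ IsLocalRing.maximalIdeal (Localization.AtPrime M),
      IsSMulRegular (Localization.AtPrime M) r := by
    by_contra! hcon
    refine hdepth ?_
    rw [localRingDepth, ← bot_eq_zero, eq_bot_iff, iSup₂_le_iff]
    rintro (_ | ⟨r, rs⟩) ⟨hmem, hrs⟩
    · simp
    · exact absurd ((RingTheory.Sequence.isRegular_cons_iff _ _ _).1 hrs).1
        (hcon r (hmem r (by simp)))
  by_contra! hcon
  have hsub : (M : Set A) ⊆ ⋃ P ∈ associatedPrimes A A, (id P : Ideal A) := by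
    simp_rw [id, biUnion_associatedPrimes_eq_compl_nonZeroDivisors]
    exact hcon
  obtain ⟨P, hP, hle⟩ := (M.subset_union_prime_finite (associatedPrimes.finite A A) (f := id)
    0 0 fun _ h _ _ => h.isPrime).1 hsub
  obtain rfl : M = P := hM.eq_of_le hP.isPrime.ne_top hle
  rw [AssociatedPrimes.mem_iff, isAssociatedPrime_iff] at hP
  obtain ⟨_, x, hx⟩ := hP
  have hkill : ∀ q ∈ IsLocalRing.maximalIdeal (Localization.AtPrime M),
      q * algebraMap A _ x = 0 := by
    intro q hq
    rw [← Localization.AtPrime.map_eq_maximalIdeal] at hq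
    refine Submodule.span_induction ?_ (zero_mul _) ?_ ?_ hq
    · rintro _ ⟨m, hm, rfl⟩
      rw [SetLike.mem_coe, hx, Submodule.mem_colon_singleton, Submodule.mem_bot, smul_eq_mul] at hm
      rw [← map_mul, hm, map_zero]
    · intro a b _ _ ha hb
      rw [add_mul, ha, hb, add_zero]
    · intro c a _ ha
      rw [smul_eq_mul, mul_assoc, ha, mul_zero]
  have hx0 : algebraMap A (Localization.AtPrime M) x = 0 :=
    hreg (by simp only [smul_eq_mul]; rw [hkill r hr, mul_zero])
  rw [IsLocalization.map_eq_zero_iff M.primeCompl] at hx0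
  obtain ⟨t, ht⟩ := hx0
  refine t.2 ?_
  change (t : A) ∈ M
  generalize (t : A) = t' at ht
  rw [hx, Submodule.mem_colon_singleton, Submodule.mem_bot, smul_eq_mul, ht]

theorem isArtinian_of_forall_smul_eq_zero [IsNoetherianRing A]
    (hdim : ∀ s ∈ A⁰, ∀ P : Ideal A, P.IsPrime → s ∈ P → P.IsMaximal) {s : A} (hs : s ∈ A⁰)
    (N : Type*) [AddCommGroup N] [Module A N] [Module.Finite A N] (hN : ∀ x : N, s • x = 0) :
    IsArtinian A N := by
  let J := Ideal.span {s}
  have hJ : Module.IsTorsionBySet A N (J : Set A) :=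
    (Module.isTorsionBySet_span_singleton_iff s).2 hN
  let _ := hJ.module
  have := hJ.isScalarTower (S := A)
  have : Module.Finite (A ⧸ J) N := Module.Finite.of_restrictScalars_finite A _ _
  have : IsArtinianRing (A ⧸ J) := by
    rw [isArtinianRing_iff_krullDimLE_zero]
    refine Ring.krullDimLE_zero_iff.2 fun P hP => ?_
    have h1 := hdim s hs (P.comap (Ideal.Quotient.mk J)) inferInstance (by
      rw [Ideal.mem_comap, Ideal.Quotient.eq_zero_iff_mem.2 (Ideal.mem_span_singleton_self s)]
      exact P.zero_mem)
    rw [← Ideal.map_comap_of_surjective _ Ideal.Quotient.mk_surjective P]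
    refine (Ideal.map_eq_top_or_isMaximal_of_surjective _ Ideal.Quotient.mk_surjective
      h1).resolve_left fun h => hP.ne_top ?_
    rwa [Ideal.map_comap_of_surjective _ Ideal.Quotient.mk_surjective P] at h
  have : IsArtinian (A ⧸ J) N := inferInstance
  exact isArtinian_of_surjective_algebraMap (Ideal.Quotient.mk_surjective (I := J))

variable {K : Type*} [CommRing K] [Algebra A K]

/-- The determinant trick; the unit `u ∈ N` plays the role of faithfulness. -/
theorem isIntegral_of_forall_mul_mem {N : Submodule A K} (hN : N.FG) {u : K} (hu : IsUnit u)
    (huN : u ∈ N) {t : K} (ht : ∀ x ∈ N, t * x ∈ N) : IsIntegral A t := by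
  have : Module.Finite A N := Module.Finite.iff_fg.2 hN
  let f : Module.End A N := (LinearMap.mulLeft A t).restrict ht
  obtain ⟨p, hp, hpf⟩ := LinearMap.exists_monic_and_aeval_eq_zero A f
  refine ⟨p, hp, ?_⟩
  have key (q : Polynomial A) (x : N) : ((Polynomial.aeval f q x : N) : K) =
      Polynomial.aeval t q * x := by
    induction q using Polynomial.induction_on' with
    | add p q hp hq => simp [hp, hq, add_mul]
    | monomial n r =>
      have hpow : ((f ^ n) x : K) = t ^ n * x := by
        induction n with
        | zero => simp
        | succ n ih => rw [pow_succ', Module.End.mul_apply, pow_succ', mul_assoc, ← ih]; rfl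
      simp [Polynomial.aeval_monomial, Algebra.smul_def, hpow, mul_assoc]
  have := key p ⟨u, huN⟩
  rw [hpf] at this
  exact hu.mul_left_eq_zero.1 this.symm

theorem tmul_one_eq_one_tmul_map {C C' : Type*} [CommRing C] [CommRing C'] [Algebra A C]
    [Algebra A C'] (f : C →ₐ[A] C') {z : C} (hz : z ⊗ₜ[A] (1 : C) = 1 ⊗ₜ[A] z) :
    f z ⊗ₜ[A] (1 : C') = 1 ⊗ₜ[A] f z := by
  simpa using congrArg (Algebra.TensorProduct.map f f) hz

/-- Tensor products commute with directed unions; the two factors are shrunk one after the other. -/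
theorem exists_fg_tmul_one_eq_one_tmul {B : Type*} [CommRing B] [Algebra A B] {z : B}
    (hz : z ⊗ₜ[A] (1 : B) = 1 ⊗ₜ[A] z) : ∃ (C : Subalgebra A B) (hzC : z ∈ C), C.FG ∧
      (⟨z, hzC⟩ : C) ⊗ₜ[A] (1 : C) = 1 ⊗ₜ[A] ⟨z, hzC⟩ := by
  let C₀ := Algebra.adjoin A {z}
  have hz₀ : z ∈ C₀ := Algebra.self_mem_adjoin_singleton A z
  have hC₀ : C₀.FG := ⟨{z}, by simp [C₀]⟩
  obtain ⟨C₁, hle₁, hC₁, e₁⟩ := TensorProduct.Algebra.eq_of_fg_of_subtype_eq hC₀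
    (t := (⟨z, hz₀⟩ : C₀) ⊗ₜ[A] (1 : B)) (t' := 1 ⊗ₜ z) hz
  have e₁' : (⟨z, hle₁ hz₀⟩ : C₁) ⊗ₜ[A] (1 : B) = 1 ⊗ₜ z := e₁
  obtain ⟨C₂, hle₂, hC₂, e₂⟩ := TensorProduct.Algebra.eq_of_fg_of_subtype_eq hC₀
    (t := (⟨z, hz₀⟩ : C₀) ⊗ₜ[A] (1 : C₁)) (t' := 1 ⊗ₜ ⟨z, hle₁ hz₀⟩)
    (congrArg (TensorProduct.comm A C₁ B) e₁').symm
  have e₂' : (⟨z, hle₂ hz₀⟩ : C₂) ⊗ₜ[A] (1 : C₁) = 1 ⊗ₜ ⟨z, hle₁ hz₀⟩ := e₂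
  have h₁ : C₁ ≤ C₁ ⊔ C₂ := le_sup_left
  have h₂ : C₂ ≤ C₁ ⊔ C₂ := le_sup_right
  refine ⟨C₁ ⊔ C₂, h₁ (hle₁ hz₀), hC₁.sup hC₂, ?_⟩
  exact congrArg (Algebra.TensorProduct.map (Subalgebra.inclusion h₂)
    (Subalgebra.inclusion h₁)) e₂'

end

/-! ### Arf rings are strictly closed -/

section FractionRing

variable {A K : Type*} [CommRing A] [CommRing K] [Algebra A K] [IsFractionRing A K]

theorem isUnit_algebraMap_iff_mem_nonZeroDivisors {s : A} :
    IsUnit (algebraMap A K s) ↔ s ∈ A⁰ := by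
  refine ⟨fun h => ?_, fun h => IsLocalization.map_units K ⟨s, h⟩⟩
  rw [mem_nonZeroDivisors_iff_right]
  intro x hx
  refine IsFractionRing.injective A K ?_
  rw [map_zero, ← h.mul_left_eq_zero, ← map_mul, hx, map_zero]

theorem exists_mem_nonZeroDivisors_mul_mem (C : Subalgebra A K) [Module.Finite A C] :
    ∃ s ∈ A⁰, ∀ c ∈ C, ∃ r, algebraMap A K r = algebraMap A K s * c := by
  obtain ⟨S, hS⟩ := (Module.Finite.iff_fg (N := C.toSubmodule)).1
    (inferInstanceAs (Module.Finite A C))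
  obtain ⟨s, hs⟩ := IsLocalization.exist_integer_multiples_of_finset A⁰ S
  refine ⟨s, s.2, fun c hc => ?_⟩
  replace hc : c ∈ Submodule.span A (S : Set K) := hS ▸ hc
  induction hc using Submodule.span_induction with
  | mem x hx =>
    obtain ⟨r, hr⟩ := hs x hx
    exact ⟨r, by rw [hr, Algebra.smul_def]⟩
  | zero => exact ⟨0, by simp⟩
  | add x y _ _ hx hy =>
    obtain ⟨r, hr⟩ := hx
    obtain ⟨r', hr'⟩ := hy
    exact ⟨r + r', by rw [map_add, hr, hr', mul_add]⟩
  | smul a x _ hx =>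
    obtain ⟨r, hr⟩ := hx
    exact ⟨a * r, by rw [map_mul, hr, Algebra.smul_def, mul_left_comm]⟩

theorem IsArfRing.isArfIn [IsNoetherianRing A] (h : IsArfRing A)
    (hreg : ∀ M : Ideal A, M.IsMaximal → ∃ s ∈ M, s ∈ A⁰) : IsArfIn A (FractionRing A) := by
  set K := FractionRing A
  refine ⟨IsFractionRing.injective A K, ?_, ?_, ?_⟩
  · rintro I ⟨s, hs, hsu⟩ hI
    obtain ⟨a, ha, n, hn⟩ := h.hasPrincipalReduction I
      ⟨s, hs, isUnit_algebraMap_iff_mem_nonZeroDivisors.1 hsu⟩ hI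
    -- `a` divides `s ^ (n + 1)`. Then `x/a` maps `I ^ n` into itself and is therefore integral.
    have hau : IsUnit (algebraMap A K a) := by
      have h1 := Ideal.pow_mem_pow hs (n + 1)
      rw [hn] at h1
      obtain ⟨z, _, hz⟩ := Ideal.mem_span_singleton_mul.1 h1
      have h2 := hsu.pow (n + 1)
      rw [← map_pow, ← hz, map_mul] at h2
      exact isUnit_of_mul_isUnit_left h2
    refine ⟨a, ha, hau, fun x hx => ?_⟩
    obtain ⟨u, hu⟩ := hau
    refine ⟨↑u⁻¹ * algebraMap A K x, ?_, by rw [← hu, Units.mul_inv_cancel_left]⟩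
    refine isIntegral_of_forall_mul_mem (N := Submodule.map (Algebra.linearMap A K) (I ^ n))
      ((IsNoetherian.noetherian (I ^ n)).map _) (u := algebraMap A K (s ^ n))
      (by rw [map_pow]; exact hsu.pow n) ⟨_, Ideal.pow_mem_pow hs n, rfl⟩ ?_
    rintro _ ⟨y, hy, rfl⟩
    have h1 : x * y ∈ I ^ (n + 1) := by
      rw [pow_succ']
      exact Ideal.mul_mem_mul hx hy
    rw [hn] at h1
    obtain ⟨z, hz, e⟩ := Ideal.mem_span_singleton_mul.1 h1
    refine ⟨z, hz, ?_⟩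
    rw [Algebra.linearMap_apply, Algebra.linearMap_apply, mul_assoc, ← map_mul, ← e, map_mul, ← hu,
      Units.inv_mul_cancel_left]
  · intro x y z t t' hx ht ht' e e'
    let x' : A⁰ := ⟨x, isUnit_algebraMap_iff_mem_nonZeroDivisors.1 hx⟩
    have h1 : IsLocalization.mk' K y x' = t :=
      IsLocalization.mk'_eq_iff_eq_mul.2 (by rw [e, mul_comm])
    have h2 : IsLocalization.mk' K z x' = t' :=
      IsLocalization.mk'_eq_iff_eq_mul.2 (by rw [e', mul_comm])
    obtain ⟨r, hr⟩ := h.mul_div_mem x' y z (h1 ▸ ht) (h2 ▸ ht')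
    refine ⟨r, hr.trans (IsLocalization.mk'_eq_iff_eq_mul.2 ?_)⟩
    rw [map_mul, e, e']
    ring
  · intro M hM
    obtain ⟨s, hs, hs'⟩ := hreg M hM
    exact ⟨s, hs, isUnit_algebraMap_iff_mem_nonZeroDivisors.2 hs'⟩

end FractionRing

theorem length_quotient_one_ne_top {A K : Type*} [CommRing A] [CommRing K] [Algebra A K]
    [IsFractionRing A K] [IsNoetherianRing A]
    (hdim : ∀ s ∈ A⁰, ∀ P : Ideal A, P.IsPrime → s ∈ P → P.IsMaximal)
    (C : Subalgebra A K) [Module.Finite A C] :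
    Module.length A (C ⧸ (1 : Submodule A C)) ≠ ⊤ := by
  obtain ⟨s, hs, hsC⟩ := exists_mem_nonZeroDivisors_mul_mem C
  have := isArtinian_of_forall_smul_eq_zero hdim hs (C ⧸ (1 : Submodule A C)) (by
    intro x
    obtain ⟨c, rfl⟩ := Submodule.mkQ_surjective _ x
    rw [← map_smul, Submodule.mkQ_apply, Submodule.Quotient.mk_eq_zero, Submodule.mem_one]
    obtain ⟨r, hr⟩ := hsC c c.2
    exact ⟨r, Subtype.val_injective (hr.trans (Algebra.smul_def _ _).symm)⟩)
  exact Module.length_ne_top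

theorem IsArfIn.exists_algebraMap_eq {A K : Type u} [CommRing A] [CommRing K] [Algebra A K]
    [IsFractionRing A K] [IsNoetherianRing A] (h : IsArfIn A K)
    (hdim : ∀ s ∈ A⁰, ∀ P : Ideal A, P.IsPrime → s ∈ P → P.IsMaximal)
    {z : integralClosure A K} (hz : z ⊗ₜ[A] (1 : integralClosure A K) = 1 ⊗ₜ[A] z) :
    ∃ r, algebraMap A K r = z := by
  obtain ⟨C, hzC, hfg, e⟩ := exists_fg_tmul_one_eq_one_tmul hz
  have : Module.Finite A C := by
    have : Algebra.FiniteType A C := ⟨(Subalgebra.fg_top C).2 hfg⟩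
    have : Algebra.IsIntegral A C := Algebra.IsIntegral.of_injective C.val Subtype.val_injective
    exact Algebra.IsIntegral.finite
  let C' := C.map (integralClosure A K).val
  let f : C →ₐ[A] C' := ((integralClosure A K).val.comp C.val).codRestrict C' fun c => ⟨c, c.2, rfl⟩
  have : Module.Finite A C' := Module.Finite.of_surjective f.toLinearMap (by
    rintro ⟨_, c, hc, rfl⟩
    exact ⟨⟨c, hc⟩, rfl⟩)
  obtain ⟨r, hr⟩ := h.mem_range_of_tmul_eq C' (length_quotient_one_ne_top hdim C')
    (tmul_one_eq_one_tmul_map f e)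
  exact ⟨r, congrArg Subtype.val hr⟩

theorem IsArfRing.isStrictlyClosed {A : Type*} [CommRing A] [IsNoetherianRing A] (h : IsArfRing A)
    (hdim : ∀ s ∈ A⁰, ∀ P : Ideal A, P.IsPrime → s ∈ P → P.IsMaximal)
    (hreg : ∀ M : Ideal A, M.IsMaximal → ∃ s ∈ M, s ∈ A⁰) : IsStrictlyClosed A := by
  rw [IsStrictlyClosed, eq_bot_iff]
  intro z hz
  obtain ⟨r, hr⟩ := (h.isArfIn hreg).exists_algebraMap_eq hdim (mem_strictClosure.1 hz)
  exact Algebra.mem_bot.2 ⟨r, Subtype.val_injective hr⟩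

/-! ### Invertibility of `(1, t)` over the integral closure -/

section

variable {A K : Type*} [CommRing A] [CommRing K] [Algebra A K]

open Polynomial in
theorem coeff_divX_iterate (F : A[X]) (j i : ℕ) : (divX^[j] F).coeff i = F.coeff (i + j) := by
  induction j generalizing i with
  | zero => rfl
  | succ j ih => rw [Function.iterate_succ_apply', coeff_divX, ih, add_right_comm, add_assoc]

open Polynomial in
theorem aeval_divX_iterate (F : A[X]) (t : K) (j : ℕ) : aeval t (divX^[j] F) =
    algebraMap A K (F.coeff j) + aeval t (divX^[j + 1] F) * t := by
  conv_lhs => rw [← divX_mul_X_add (divX^[j] F)]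
  rw [map_add, map_mul, aeval_X, aeval_C, coeff_divX_iterate, zero_add, add_comm,
    Function.iterate_succ_apply']

open Polynomial in
theorem aeval_divX_iterate_mul_pow_add_sum (F : A[X]) (t : K) (j : ℕ) :
    aeval t (divX^[j] F) * t ^ j + ∑ i ∈ Finset.range j, algebraMap A K (F.coeff i) * t ^ i =
      aeval t F := by
  induction j with
  | zero => simp
  | succ j ih =>
    rw [← ih, aeval_divX_iterate F t j, Finset.sum_range_succ]
    ring

open Polynomial in
-- Descending induction on the Horner tails `q_j = a_j + a_{j+1} t + ⋯`. Once `q_{j+1}` is integral,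
-- `F(t) = 0` is a polynomial equation of `t` with leading coefficient `q_{j+1}`, so `q_{j+1} t` is
-- integral, and `q_j = a_j + q_{j+1} t`.
theorem isIntegral_aeval_divX_iterate {F : A[X]} {t : K} (hF : aeval t F = 0) (j : ℕ) :
    IsIntegral A (aeval t (divX^[j] F)) := by
  induction hk : F.natDegree + 1 - j generalizing j with
  | zero =>
    have : divX^[j] F = 0 := by
      ext i
      rw [coeff_divX_iterate, coeff_zero]
      exact coeff_eq_zero_of_natDegree_lt (by omega)
    rw [this, map_zero]
    exact isIntegral_zero
  | succ k ih =>
    have hq : IsIntegral A (aeval t (divX^[j + 1] F)) := ih (j + 1) (by omega)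
    have hsum := (aeval_divX_iterate_mul_pow_add_sum F t (j + 1)).trans hF
    rw [aeval_divX_iterate]
    refine isIntegral_algebraMap.add ?_
    set q := aeval t (divX^[j + 1] F)
    let B := integralClosure A K
    let q' : B := ⟨q, hq⟩
    by_cases hq0 : q' = 0
    · rw [show q = 0 from congrArg Subtype.val hq0, zero_mul]
      exact isIntegral_zero
    let L : B[X] := ∑ i ∈ Finset.range (j + 1), C (algebraMap A B (F.coeff i)) * X ^ i
    have hL : L.degree < (C q' * X ^ (j + 1)).degree := by
      rw [degree_C_mul_X_pow _ hq0, ← mem_degreeLT]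
      refine sum_mem fun i hi => mem_degreeLT.2 ((degree_C_mul_X_pow_le _ _).trans_lt ?_)
      exact_mod_cast Finset.mem_range.1 hi
    have hlead : (L + C q' * X ^ (j + 1)).leadingCoeff = q' := by
      rw [leadingCoeff_add_of_degree_lt hL, leadingCoeff_C_mul_X_pow]
    have h := isIntegral_leadingCoeff_smul (L + C q' * X ^ (j + 1)) t (by
      rw [← hsum, add_comm]
      simp [L, q'])
    rw [hlead] at h
    exact isIntegral_trans _ h

open Polynomial in
-- Otherwise `M[X]` contains the kernel of evaluation at `t`. It is minimal over a regular constant,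
-- so has height at most one by Krull; but a minimal prime `P` of the kernel gives a chain `(P ∩
-- A)[X] < P < M[X]`.
theorem exists_coeff_notMem_of_isFractionRing [IsFractionRing A K] [IsNoetherianRing A]
    (hdim : ∀ s ∈ A⁰, ∀ P : Ideal A, P.IsPrime → s ∈ P → P.IsMaximal)
    (hreg : ∀ M : Ideal A, M.IsMaximal → ∃ s ∈ M, s ∈ A⁰) (t : K) (M : Ideal A) [hM : M.IsMaximal] :
    ∃ F : A[X], aeval t F = 0 ∧ ∃ i, F.coeff i ∉ M := by
  by_contra! hcon
  obtain ⟨s₀, hs₀M, hs₀⟩ := hreg M hM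
  obtain ⟨⟨y, s⟩, hys⟩ := IsLocalization.surj A⁰ t
  let 𝔐 : Ideal A[X] := M.map C
  have : 𝔐.IsPrime := (Ideal.isPrime_map_C_iff_isPrime M).2 hM.isPrime
  have hker : RingHom.ker (aeval (R := A) t) ≤ 𝔐 := fun F hF =>
    Ideal.mem_map_C_iff.2 (hcon F hF)
  have hmin : 𝔐 ∈ (Ideal.span {C s₀}).minimalPrimes := by
    refine ⟨⟨this, (Ideal.span_singleton_le_iff_mem _).2 (Ideal.mem_map_of_mem _ hs₀M)⟩, ?_⟩
    rintro Q ⟨hQ, hle⟩ hQM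
    have hsQ : C s₀ ∈ Q := (Ideal.span_singleton_le_iff_mem _).1 hle
    have h1 : (Q.comap C).IsMaximal := hdim s₀ hs₀ _ inferInstance hsQ
    have h2 : Q.comap C = M := by
      refine h1.eq_of_le hM.ne_top fun x hx => ?_
      simpa using Ideal.mem_map_C_iff.1 (hQM hx) 0
    rw [Ideal.map_le_iff_le_comap, h2]
  have hht := Ideal.height_le_one_of_isPrincipal_of_mem_minimalPrimes _ _ hmin
  obtain ⟨P, hP, hPM⟩ := Ideal.exists_minimalPrimes_le hker
  have hPp : P.IsPrime := hP.isPrime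
  have hregP (r : A) (hr : r ∈ A⁰) : C r ∉ P := by
    intro hrP
    obtain ⟨G, hG, hG'⟩ := Ideal.exists_mul_mem_of_mem_minimalPrimes hP hrP
    refine hG ?_
    rw [RingHom.mem_ker, map_mul, aeval_C, (IsLocalization.map_units K ⟨r, hr⟩).mul_right_eq_zero] at hG'
    exact hG'
  have hlt₂ : P < 𝔐 := lt_of_le_of_ne hPM fun h =>
    hregP s₀ hs₀ (h ▸ Ideal.mem_map_of_mem _ hs₀M)
  let p : Ideal A[X] := (P.comap C).map C
  have : p.IsPrime := (Ideal.isPrime_map_C_iff_isPrime _).2 (hPp.comap C)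
  have hlt₁ : p < P := by
    refine lt_of_le_of_ne (Ideal.map_comap_le) fun h => ?_
    -- Writing `t = y/s`, the polynomial `sX - y` lies in `P` but not in `(P ∩ A)[X]`, as `s` is
    -- regular.
    have h1 : C (s : A) * X - C y ∈ P := hP.1.2 (by
      rw [RingHom.mem_ker, map_sub, map_mul, aeval_C, aeval_X, aeval_C, mul_comm, hys, sub_self])
    rw [← h] at h1
    have h2 := Ideal.mem_map_C_iff.1 h1 1
    simp [coeff_C] at h2
    exact hregP s s.2 h2
  have h1 := Ideal.height_le_iff.1 hht P hPp hlt₂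
  rw [Nat.cast_one, Order.lt_one_iff, Ideal.height_eq_zero_iff] at h1
  exact hlt₁.not_ge (h1.2 ⟨this, bot_le⟩ hlt₁.le)

open Polynomial in
theorem exists_isIntegral_add_mul_eq_one [IsFractionRing A K] [IsNoetherianRing A]
    (hdim : ∀ s ∈ A⁰, ∀ P : Ideal A, P.IsPrime → s ∈ P → P.IsMaximal)
    (hreg : ∀ M : Ideal A, M.IsMaximal → ∃ s ∈ M, s ∈ A⁰) (t : K) :
    ∃ d e : K, IsIntegral A d ∧ IsIntegral A (d * t) ∧ IsIntegral A e ∧ IsIntegral A (e * t) ∧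
      d + e * t = 1 := by
  let E : Ideal (integralClosure A K) :=
    { carrier := {r | ∃ d e : K, IsIntegral A d ∧ IsIntegral A (d * t) ∧ IsIntegral A e ∧
        IsIntegral A (e * t) ∧ d + e * t = r}
      zero_mem' := ⟨0, 0, by simp [isIntegral_zero]⟩
      add_mem' := by
        rintro r r' ⟨d, e, h1, h2, h3, h4, h5⟩ ⟨d', e', h1', h2', h3', h4', h5'⟩
        exact ⟨d + d', e + e', h1.add h1', by rw [add_mul]; exact h2.add h2', h3.add h3',
          by rw [add_mul]; exact h4.add h4', by rw [Subalgebra.coe_add, ← h5, ← h5']; ring⟩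
      smul_mem' := by
        rintro c r ⟨d, e, h1, h2, h3, h4, h5⟩
        have hc : IsIntegral A (c : K) := c.2
        exact ⟨c * d, c * e, hc.mul h1, by rw [mul_assoc]; exact hc.mul h2, hc.mul h3,
          by rw [mul_assoc]; exact hc.mul h4, by
            rw [smul_eq_mul, Subalgebra.coe_mul, ← h5]; ring⟩ }
  suffices h : E = ⊤ by
    have h1 : (1 : integralClosure A K) ∈ E := h ▸ Submodule.mem_top
    exact h1
  by_contra hE
  obtain ⟨N, hN, hle⟩ := E.exists_le_maximal hE
  obtain ⟨F, hF, i, hi⟩ := exists_coeff_notMem_of_isFractionRing hdim hreg t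
    (hM := Ideal.isMaximal_comap_of_isIntegral_of_isMaximal (R := A) N)
  refine hi (hle ?_)
  have hint (j : ℕ) := isIntegral_aeval_divX_iterate hF j
  have hint' (j : ℕ) : IsIntegral A (aeval t (divX^[j + 1] F) * t) := by
    rw [← add_sub_cancel_left (algebraMap A K (F.coeff j)) (_ * t), ← aeval_divX_iterate]
    exact (hint j).sub isIntegral_algebraMap
  -- Consecutive Horner tails satisfy `q_i - q_{i+1} t = a_i`, so `E` contains every coefficient of
  -- `F`.
  refine ⟨aeval t (divX^[i] F), -aeval t (divX^[i + 1] F), hint i, ?_, (hint _).neg, ?_, ?_⟩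
  · cases i with
    | zero => rw [Function.iterate_zero_apply, hF, zero_mul]; exact isIntegral_zero
    | succ i => exact hint' i
  · rw [neg_mul]
    exact (hint' i).neg
  · rw [aeval_divX_iterate F t i, neg_mul, add_neg_cancel_right]
    rfl

end

/-! ### Principal extensions of ideals to semi-local finite algebras -/

section

variable {R : Type*} [CommRing R]

theorem exists_forall_sub_mem_maximal [Finite (MaximalSpectrum R)] (f : MaximalSpectrum R → R) :
    ∃ q : R, ∀ n : MaximalSpectrum R, q - f n ∈ n.asIdeal := by
  obtain ⟨q, hq⟩ := Ideal.quotientInfToPiQuotient_surj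
    (I := fun n : MaximalSpectrum R => n.asIdeal) (fun n n' h =>
      Ideal.isCoprime_of_isMaximal fun h' => h (MaximalSpectrum.ext h'))
    (fun n => Ideal.Quotient.mk _ (f n))
  obtain ⟨q, rfl⟩ := Ideal.Quotient.mk_surjective q
  exact ⟨q, fun n => Ideal.Quotient.eq.1 (congrFun hq n)⟩

theorem eq_top_of_forall_maximalSpectrum {I : Ideal R} (h : ∀ n : MaximalSpectrum R, ¬I ≤ n.asIdeal) :
    I = ⊤ := by
  by_contra hI
  obtain ⟨n, hn, hle⟩ := I.exists_le_maximal hI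
  exact h ⟨n, hn⟩ hle

variable {A K : Type*} [CommRing A] [CommRing K] [Algebra A K]

/-- An invertible ideal over a semi-local ring is principal: `p + q t` generates `(1, t)`, since its
multiple by `h` is `1` and `h t ∈ C`. -/
theorem Subalgebra.exists_add_mul_mul_eq_one (C : Subalgebra A K) [Finite (MaximalSpectrum C)]
    {d e t : K} (hd : d ∈ C) (hdt : d * t ∈ C) (he : e ∈ C) (het : e * t ∈ C)
    (h : d + e * t = 1) : ∃ p ∈ C, ∃ q ∈ C, ∃ h ∈ C, h * t ∈ C ∧ (p + q * t) * h = 1 := by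
  classical
  -- The generator `(1 - q) + q t` is congruent to `t` where `d` vanishes and to `1` elsewhere; `u`
  -- and `v` are its multiples by `d` and `e`.
  obtain ⟨q, hq⟩ := exists_forall_sub_mem_maximal
    fun n : MaximalSpectrum C => if (⟨d, hd⟩ : C) ∈ n.asIdeal then 1 else 0
  let u : C := (1 - q) * ⟨d, hd⟩ + q * ⟨d * t, hdt⟩
  let v : C := (1 - q) * ⟨e, he⟩ + q * ⟨e * t, het⟩
  have htop : Ideal.span {u, v} = ⊤ := by
    refine eq_top_of_forall_maximalSpectrum fun n hn => ?_
    have hnp := n.isMaximal.isPrime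
    have hu : u ∈ n.asIdeal := hn (Ideal.subset_span (by simp))
    have hv : v ∈ n.asIdeal := hn (Ideal.subset_span (by simp))
    have hqn := hq n
    split_ifs at hqn with hdn
    · have h1 : (⟨e * t, het⟩ : C) ∈ n.asIdeal := by
        have : (⟨e * t, het⟩ : C) = v - (q - 1) * (⟨e * t, het⟩ - ⟨e, he⟩) := by
          simp only [v]; ring
        rw [this]
        exact sub_mem hv (n.asIdeal.mul_mem_right _ hqn)
      apply hnp.ne_top
      rw [Ideal.eq_top_iff_one, show (1 : C) = ⟨d, hd⟩ + ⟨e * t, het⟩ from Subtype.ext h.symm]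
      exact add_mem hdn h1
    · rw [sub_zero] at hqn
      apply hdn
      have : (⟨d, hd⟩ : C) = u - q * (⟨d * t, hdt⟩ - ⟨d, hd⟩) := by simp only [u]; ring
      rw [this]
      exact sub_mem hu (n.asIdeal.mul_mem_right _ hqn)
  obtain ⟨α, β, hαβ⟩ := Ideal.mem_span_pair.1 (htop ▸ Submodule.mem_top : (1 : C) ∈ Ideal.span {u, v})
  refine ⟨_, (1 - q).2, q, q.2, (α : K) * d + β * e, add_mem (mul_mem α.2 hd) (mul_mem β.2 he),
    ?_, ?_⟩
  · rw [add_mul, mul_assoc, mul_assoc]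
    exact add_mem (mul_mem α.2 hdt) (mul_mem β.2 het)
  · have h1 : (α : K) * ((1 - q : C) * d + q * (d * t)) + β * ((1 - q : C) * e + q * (e * t)) = 1 :=
      congrArg Subtype.val hαβ
    rw [← h1]
    ring

theorem isArtinianRing_quotient_of_finite [IsNoetherianRing A]
    (hdim : ∀ s ∈ A⁰, ∀ P : Ideal A, P.IsPrime → s ∈ P → P.IsMaximal) {s : A} (hs : s ∈ A⁰)
    (C : Type*) [CommRing C] [Algebra A C] [Module.Finite A C] :
    IsArtinianRing (C ⧸ Ideal.span {algebraMap A C s}) := by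
  have := isArtinian_of_forall_smul_eq_zero hdim hs (C ⧸ Ideal.span {algebraMap A C s}) (by
    intro x
    obtain ⟨c, rfl⟩ := Ideal.Quotient.mk_surjective x
    rw [← Ideal.Quotient.mkₐ_eq_mk A, ← map_smul, Ideal.Quotient.mkₐ_eq_mk,
      Ideal.Quotient.eq_zero_iff_mem, Algebra.smul_def]
    exact Ideal.mul_mem_right _ _ (Ideal.mem_span_singleton_self _))
  exact isArtinian_of_tower A this

theorem exists_mem_nonZeroDivisors_forall_mem_maximal [Finite (MaximalSpectrum A)]
    (hreg : ∀ M : Ideal A, M.IsMaximal → ∃ s ∈ M, s ∈ A⁰) :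
    ∃ s ∈ A⁰, ∀ M : Ideal A, M.IsMaximal → s ∈ M := by
  have := Fintype.ofFinite (MaximalSpectrum A)
  choose! s hs hs' using hreg
  refine ⟨∏ M : MaximalSpectrum A, s M.asIdeal, prod_mem fun M _ => hs' _ M.isMaximal,
    fun M hM => ?_⟩
  exact Ideal.mem_of_dvd _ (Finset.dvd_prod_of_mem (fun M : MaximalSpectrum A => s M.asIdeal)
    (Finset.mem_univ ⟨M, hM⟩)) (hs M hM)

theorem finite_maximalSpectrum_of_finite [IsNoetherianRing A] [Finite (MaximalSpectrum A)]
    (hdim : ∀ s ∈ A⁰, ∀ P : Ideal A, P.IsPrime → s ∈ P → P.IsMaximal)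
    (hreg : ∀ M : Ideal A, M.IsMaximal → ∃ s ∈ M, s ∈ A⁰)
    (C : Type*) [CommRing C] [Algebra A C] [Module.Finite A C] : Finite (MaximalSpectrum C) := by
  obtain ⟨s, hs, hsM⟩ := exists_mem_nonZeroDivisors_forall_mem_maximal hreg
  have := isArtinianRing_quotient_of_finite hdim hs C
  let J := Ideal.span {algebraMap A C s}
  have hJ (n : MaximalSpectrum C) : J ≤ n.asIdeal := by
    have := n.isMaximal
    rw [Ideal.span_singleton_le_iff_mem]
    exact hsM (n.asIdeal.comap (algebraMap A C))
      (Ideal.isMaximal_comap_of_isIntegral_of_isMaximal n.asIdeal)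
  have hcomap (n : MaximalSpectrum C) :
      (n.asIdeal.map (Ideal.Quotient.mk J)).comap (Ideal.Quotient.mk J) = n.asIdeal := by
    rw [Ideal.comap_map_of_surjective _ Ideal.Quotient.mk_surjective, ← RingHom.ker_eq_comap_bot,
      Ideal.mk_ker, sup_eq_left.2 (hJ n)]
  refine Finite.of_injective (β := MaximalSpectrum (C ⧸ J)) (fun n =>
    ⟨n.asIdeal.map (Ideal.Quotient.mk J), (Ideal.map_eq_top_or_isMaximal_of_surjective _
      Ideal.Quotient.mk_surjective n.isMaximal).resolve_left fun h => n.isMaximal.ne_top ?_⟩) ?_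
  · rw [← hcomap n, h, Ideal.comap_top]
  · intro n n' h
    have h' := congrArg MaximalSpectrum.asIdeal h
    exact MaximalSpectrum.ext (by rw [← hcomap n, ← hcomap n']; exact congrArg _ h')

theorem Subalgebra.mem_span_of_le {C C' : Subalgebra A K} (hle : C ≤ C') {S T : Set K} (hST : S ⊆ T)
    {b : K} (hb : b ∈ Submodule.span C S) : b ∈ Submodule.span C' T := by
  induction hb using Submodule.span_induction with
  | mem y hy => exact Submodule.subset_span (hST hy)
  | zero => exact zero_mem _
  | add y z _ _ hy hz => exact add_mem hy hz
  | smul c y _ hy => exact Submodule.smul_mem _ (⟨c, hle c.2⟩ : C') hy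

theorem exists_finite_subalgebra_span_eq_span_singleton [IsFractionRing A K] [IsNoetherianRing A]
    [Finite (MaximalSpectrum A)]
    (hdim : ∀ s ∈ A⁰, ∀ P : Ideal A, P.IsPrime → s ∈ P → P.IsMaximal)
    (hreg : ∀ M : Ideal A, M.IsMaximal → ∃ s ∈ M, s ∈ A⁰) {u : K} (hu : IsUnit u) (S : Finset K) :
    ∃ C : Subalgebra A K, Module.Finite A C ∧ ∃ b : K, IsUnit b ∧
      b ∈ Submodule.span C (insert u (S : Set K)) ∧
      ∀ x ∈ insert u (S : Set K), ∃ c ∈ C, x = b * c := by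
  classical
  induction S using Finset.induction_on with
  | empty =>
    refine ⟨⊥, inferInstance, u, hu, Submodule.subset_span (by simp), ?_⟩
    intro x hx
    exact ⟨1, one_mem _, by simpa using hx⟩
  | insert x S _ ih =>
    obtain ⟨C, hC, b, hb, hbS, hS⟩ := ih
    obtain ⟨t, rfl⟩ : ∃ t, x = b * t := by
      obtain ⟨b', rfl⟩ := hb
      exact ⟨↑b'⁻¹ * x, by simp⟩
    obtain ⟨d, e, hd, hdt, he, het, h⟩ := exists_isIntegral_add_mul_eq_one hdim hreg t
    let D := Algebra.adjoin A ({d, d * t, e, e * t} : Set K)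
    have hD : Module.Finite A D := Algebra.finite_adjoin_of_finite_of_isIntegral (Set.toFinite _)
      (by rintro y (rfl | rfl | rfl | rfl) <;> assumption)
    let C' := C ⊔ D
    have hC' : Module.Finite A C' := Subalgebra.finite_sup _ _
    have hle : C ≤ C' := le_sup_left
    have hmem {y : K} (hy : y ∈ ({d, d * t, e, e * t} : Set K)) : y ∈ C' :=
      (le_sup_right : D ≤ C') (Algebra.subset_adjoin hy)
    have := finite_maximalSpectrum_of_finite hdim hreg C'
    obtain ⟨p, hp, q, hq, r, hr, hrt, hpq⟩ := C'.exists_add_mul_mul_eq_one (hmem (by simp))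
      (hmem (by simp)) (hmem (by simp)) (hmem (by simp)) h
    refine ⟨C', hC', b * (p + q * t), hb.mul (.of_mul_eq_one _ hpq), ?_, ?_⟩
    · have hbS' : b ∈ Submodule.span C' (insert u ((insert (b * t) S : Finset K) : Set K)) :=
        Subalgebra.mem_span_of_le hle (Set.insert_subset_insert (by simp)) hbS
      have hxS : b * t ∈ Submodule.span C' (insert u ((insert (b * t) S : Finset K) : Set K)) :=
        Submodule.subset_span (by simp)
      have h1 := add_mem (Submodule.smul_mem _ (⟨p, hp⟩ : C') hbS')
        (Submodule.smul_mem _ (⟨q, hq⟩ : C') hxS)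
      convert h1 using 1
      rw [Subalgebra.smul_def, Subalgebra.smul_def, smul_eq_mul, smul_eq_mul]
      ring
    · intro y hy
      by_cases hyx : y = b * t
      · exact ⟨r * t, hrt, by rw [hyx, mul_assoc, ← mul_assoc _ r, hpq, one_mul]⟩
      · obtain ⟨c, hc, e⟩ := hS y (by
          rw [Finset.coe_insert] at hy
          rcases hy with hy | hy | hy
          · exact .inl hy
          · exact absurd hy hyx
          · exact .inr hy)
        exact ⟨r * c, mul_mem hr (hle hc), by rw [e, mul_assoc, ← mul_assoc _ r, hpq, one_mul]⟩

end

/-! ### Producing elements of the strict closure -/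

section

variable {A : Type*} [CommRing A]

theorem smul_mem_range_algebraMap_tensorProduct {C : Type*} [CommRing C] [Algebra A C] {c₀ : A}
    (hc₀ : ∀ c : C, ∃ r : A, algebraMap A C r = c₀ • c) (ρ : C ⊗[A] C) :
    ∃ r : A, c₀ • ρ = algebraMap A (C ⊗[A] C) r := by
  induction ρ with
  | zero => exact ⟨0, by simp⟩
  | add x y hx hy =>
    obtain ⟨r, hr⟩ := hx
    obtain ⟨r', hr'⟩ := hy
    exact ⟨r + r', by rw [smul_add, hr, hr', map_add]⟩
  | tmul p q =>
    obtain ⟨r, hr⟩ := hc₀ p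
    obtain ⟨r', hr'⟩ := hc₀ (p * q)
    refine ⟨r', ?_⟩
    rw [Algebra.TensorProduct.algebraMap_apply, TensorProduct.smul_tmul', ← hr,
      Algebra.TensorProduct.tmul_one_eq_one_tmul, hr', Algebra.algebraMap_eq_smul_one,
      TensorProduct.smul_tmul, ← smul_mul_assoc, ← hr, ← Algebra.smul_def]

/-- Since `IC = bC`, `b ⊗ 1 = (1 ⊗ b)γ`, and `x = bβ ∈ A` lets `β` change sides at the cost of `γ`.
Hence `ye ⊗ β^m g` is a multiple of `eβ^m ⊗ 1`, so lies in `c₀(C ⊗ C)`, thus in the image of `A`,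
and is symmetric. As `ye ⊗ e` is symmetric too, so is their sum `ye ⊗ 1`. -/
theorem mul_tmul_one_eq_one_tmul_mul {C : Type*} [CommRing C] [Algebra A C] {I : Ideal A} {b : C}
    (hb : b ∈ I.map (algebraMap A C)) (hI : ∀ x ∈ I, ∃ β, algebraMap A C x = b * β) {c₀ : A}
    (hc₀ : ∀ c : C, ∃ r : A, algebraMap A C r = c₀ • c) {x y : A} {β e g k : C} {m : ℕ}
    (hx : algebraMap A C x = b * β) (hy : y ∈ I)
    (he : e * β ^ m = c₀ • k) (hg : e + β ^ m * g = 1) :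
    (algebraMap A C y * e) ⊗ₜ[A] (1 : C) = 1 ⊗ₜ[A] (algebraMap A C y * e) := by
  have hγ : ∀ u ∈ I.map (algebraMap A C), ∃ γ : C ⊗[A] C, u ⊗ₜ[A] (1 : C) = (1 ⊗ₜ b) * γ := by
    intro u hu
    induction hu using Submodule.span_induction with
    | mem u hu =>
      obtain ⟨x, hx, rfl⟩ := hu
      obtain ⟨β, hβ⟩ := hI x hx
      exact ⟨1 ⊗ₜ β, by
        rw [Algebra.TensorProduct.tmul_one_eq_one_tmul, hβ, Algebra.TensorProduct.tmul_mul_tmul,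
          one_mul]⟩
    | zero => exact ⟨0, by simp⟩
    | add u v _ _ hu hv =>
      obtain ⟨γ, h⟩ := hu
      obtain ⟨γ', h'⟩ := hv
      exact ⟨γ + γ', by rw [TensorProduct.add_tmul, h, h', mul_add]⟩
    | smul c u _ hu =>
      obtain ⟨γ, h⟩ := hu
      exact ⟨(c ⊗ₜ 1) * γ, by
        rw [mul_left_comm, ← h, Algebra.TensorProduct.tmul_mul_tmul, one_mul, smul_eq_mul]⟩
  obtain ⟨γ, hγ⟩ := hγ b hb
  have hstep : (b ⊗ₜ[A] (1 : C)) * (1 ⊗ₜ β) = γ * ((b ⊗ₜ[A] (1 : C)) * (β ⊗ₜ 1)) := by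
    calc (b ⊗ₜ[A] (1 : C)) * (1 ⊗ₜ β) = γ * ((1 ⊗ₜ b) * (1 ⊗ₜ β)) := by rw [hγ]; ring
      _ = γ * ((b ⊗ₜ 1) * (β ⊗ₜ 1)) := by
        rw [Algebra.TensorProduct.tmul_mul_tmul, Algebra.TensorProduct.tmul_mul_tmul, one_mul, ← hx,
          Algebra.TensorProduct.tmul_one_eq_one_tmul]
  have hpow : (b ⊗ₜ[A] (1 : C)) * (1 ⊗ₜ β) ^ m = γ ^ m * ((b ⊗ₜ[A] (1 : C)) * (β ⊗ₜ 1) ^ m) := by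
    clear he hg
    induction m with
    | zero => simp
    | succ m ih =>
      calc (b ⊗ₜ[A] (1 : C)) * (1 ⊗ₜ β) ^ (m + 1)
          = ((b ⊗ₜ[A] (1 : C)) * (1 ⊗ₜ β) ^ m) * (1 ⊗ₜ β) := by ring
        _ = γ ^ m * (β ⊗ₜ 1) ^ m * ((b ⊗ₜ[A] (1 : C)) * (1 ⊗ₜ β)) := by rw [ih]; ring
        _ = _ := by rw [hstep]; ring
  obtain ⟨β', hβ'⟩ := hI y hy
  set ye := algebraMap A C y * e with hye
  have hz : ∃ ρ, ye ⊗ₜ[A] (β ^ m * g) = c₀ • ρ := by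
    refine ⟨γ ^ m * ((b * β' * k) ⊗ₜ g), ?_⟩
    calc ye ⊗ₜ[A] (β ^ m * g)
        = ((b ⊗ₜ[A] (1 : C)) * (1 ⊗ₜ β) ^ m) * ((β' * e) ⊗ₜ g) := by
          rw [hye, hβ', Algebra.TensorProduct.tmul_pow, Algebra.TensorProduct.tmul_mul_tmul,
            Algebra.TensorProduct.tmul_mul_tmul, one_pow, mul_one, one_mul, mul_assoc]
      _ = γ ^ m * ((b * β' * (e * β ^ m)) ⊗ₜ g) := by
          rw [hpow, Algebra.TensorProduct.tmul_pow, Algebra.TensorProduct.tmul_mul_tmul, mul_assoc,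
            Algebra.TensorProduct.tmul_mul_tmul, one_pow, one_mul, one_mul]
          congr 2
          ring
      _ = c₀ • (γ ^ m * ((b * β' * k) ⊗ₜ g)) := by
          rw [he, mul_smul_comm, ← TensorProduct.smul_tmul', mul_smul_comm]
  obtain ⟨ρ, hρ⟩ := hz
  obtain ⟨r, hr⟩ := smul_mem_range_algebraMap_tensorProduct hc₀ ρ
  rw [hr] at hρ
  have hρ' := congrArg (Algebra.TensorProduct.comm A C C) hρ
  rw [Algebra.TensorProduct.comm_tmul, AlgEquiv.commutes, ← hρ] at hρ'
  have h1 : (e * ye) = ye * e := mul_comm _ _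
  have h2 : ye ⊗ₜ[A] e = e ⊗ₜ[A] ye := by
    rw [hye, ← Algebra.smul_def, TensorProduct.smul_tmul]
  conv_lhs => rw [← hg, TensorProduct.tmul_add, h2, ← hρ', ← TensorProduct.add_tmul, hg]

/-- Cayley–Hamilton for multiplication by `w`, which maps `C` into `IC`. -/
theorem Ideal.isIntegralElem_of_algebraMap_mem_map {C : Type*} [CommRing C] [Algebra A C]
    [Module.Finite A C] (hinj : Function.Injective (algebraMap A C)) {I : Ideal A} {w : A}
    (hw : algebraMap A C w ∈ I.map (algebraMap A C)) : I.IsIntegralElem w := by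
  obtain ⟨p, hp, -, hpI, hpw⟩ :=
    LinearMap.exists_monic_and_natDegree_eq_and_coeff_mem_pow_and_aeval_eq_zero A
      (algebraMap A (Module.End A C) w) I (by
        rintro _ ⟨c, rfl⟩
        rw [Ideal.smul_top_eq_map, Submodule.restrictScalars_mem, Module.algebraMap_end_apply,
          Algebra.smul_def]
        exact Ideal.mul_mem_right _ _ hw)
  have hroot : p.eval w = 0 := by
    rw [Polynomial.aeval_algebraMap_apply] at hpw
    have := LinearMap.congr_fun hpw (1 : C)
    rw [Module.algebraMap_end_apply, LinearMap.zero_apply, Algebra.smul_def, mul_one,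
      Polynomial.coe_aeval_eq_eval] at this
    exact hinj (by rw [this, map_zero])
  rcases Nat.eq_zero_or_pos p.natDegree with h0 | hpos
  · rw [hp.natDegree_eq_zero.1 h0, Polynomial.eval_one] at hroot
    have := subsingleton_of_zero_eq_one hroot.symm
    exact ⟨1, 0, le_rfl, fun i _ => zero_mem _, Subsingleton.elim _ _⟩
  · refine ⟨p.natDegree, fun i => p.coeff (p.natDegree - i), hpos, fun i hi => ?_, ?_⟩
    · have := hpI (p.natDegree - i)
      rwa [Nat.sub_sub_self (Finset.mem_Icc.1 hi).2] at this
    · rw [← hroot, Polynomial.eval_eq_sum_range, Finset.sum_range_succ, hp.coeff_natDegree, one_mul,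
        add_comm]
      congr 1
      refine Finset.sum_bij' (fun i _ => p.natDegree - i) (fun i _ => p.natDegree - i) ?_ ?_ ?_ ?_ ?_
      all_goals
        intro i hi
        simp only [Finset.mem_Icc, Finset.mem_range] at hi ⊢
      · omega
      · omega
      · omega
      · omega

/-- With `y = xt` and `z = xt'` in `A`: `xtt' ⊗ 1 = t' ⊗ y = t' ⊗ xt = z ⊗ t = 1 ⊗ xtt'`. -/
theorem exists_eq_mul_mul_of_forall_tmul {K : Type*} [CommRing K] [Algebra A K]
    (hSC : ∀ z : integralClosure A K, z ⊗ₜ[A] (1 : integralClosure A K) = 1 ⊗ₜ[A] z →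
      ∃ r, algebraMap A K r = z) {x y z : A} {t t' : K} (ht : IsIntegral A t)
    (ht' : IsIntegral A t') (hy : algebraMap A K y = algebraMap A K x * t)
    (hz : algebraMap A K z = algebraMap A K x * t') :
    ∃ r, algebraMap A K r = algebraMap A K x * (t * t') := by
  let τ : integralClosure A K := ⟨t, ht⟩
  let τ' : integralClosure A K := ⟨t', ht'⟩
  have hy' : y • (1 : integralClosure A K) = x • τ := Subtype.ext <| by
    simpa [Algebra.smul_def] using hy
  have hz' : z • (1 : integralClosure A K) = x • τ' := Subtype.ext <| by
    simpa [Algebra.smul_def] using hz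
  have h1 : x • (τ * τ') = y • τ' := by rw [← smul_mul_assoc, ← hy', smul_mul_assoc, one_mul]
  have h2 : x • (τ * τ') = z • τ := by rw [← mul_smul_comm, ← hz', mul_smul_comm, mul_one]
  obtain ⟨r, hr⟩ := hSC (x • (τ * τ')) (by
    conv_lhs => rw [h1, TensorProduct.smul_tmul, hy', ← TensorProduct.smul_tmul, ← hz',
      TensorProduct.smul_tmul, ← h2])
  exact ⟨r, hr.trans (Algebra.smul_def _ _)⟩

end

/-! ### Principal reductions from strict closedness -/

section

variable {A K : Type*} [CommRing A] [CommRing K] [Algebra A K]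

theorem exists_finite_subalgebra_map_eq_span_singleton [IsFractionRing A K] [IsNoetherianRing A]
    [Finite (MaximalSpectrum A)]
    (hdim : ∀ s ∈ A⁰, ∀ P : Ideal A, P.IsPrime → s ∈ P → P.IsMaximal)
    (hreg : ∀ M : Ideal A, M.IsMaximal → ∃ s ∈ M, s ∈ A⁰) {I : Ideal A} (hI : ∃ s ∈ I, s ∈ A⁰) :
    ∃ C : Subalgebra A K, Module.Finite A C ∧ ∃ b ∈ I.map (algebraMap A C), IsUnit (b : K) ∧
      ∀ x ∈ I, ∃ β, algebraMap A C x = b * β := by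
  classical
  obtain ⟨s, hs, hs0⟩ := hI
  obtain ⟨S, hS⟩ := IsNoetherian.noetherian I
  obtain ⟨C, hC, b, hb, hbS, h⟩ := exists_finite_subalgebra_span_eq_span_singleton hdim hreg
    (IsLocalization.map_units K ⟨s, hs0⟩) (S.image (algebraMap A K))
  have hmem : ∃ b' ∈ I.map (algebraMap A C), (b' : K) = b := by
    clear h hb
    induction hbS using Submodule.span_induction with
    | mem y hy =>
      have : ∃ x ∈ I, algebraMap A K x = y := by
        rw [Finset.coe_image] at hy
        rcases hy with rfl | ⟨x, hx, rfl⟩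
        · exact ⟨s, hs, rfl⟩
        · exact ⟨x, hS ▸ Submodule.subset_span hx, rfl⟩
      obtain ⟨x, hx, rfl⟩ := this
      exact ⟨algebraMap A C x, Ideal.mem_map_of_mem _ hx, rfl⟩
    | zero => exact ⟨0, zero_mem _, rfl⟩
    | add y z _ _ hy hz =>
      obtain ⟨y', hy', rfl⟩ := hy
      obtain ⟨z', hz', rfl⟩ := hz
      exact ⟨y' + z', add_mem hy' hz', rfl⟩
    | smul c y _ hy =>
      obtain ⟨y', hy', rfl⟩ := hy
      exact ⟨c * y', Ideal.mul_mem_left _ _ hy', rfl⟩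
  obtain ⟨b, hbI, rfl⟩ := hmem
  refine ⟨C, hC, b, hbI, hb, fun x hx => ?_⟩
  replace hx : x ∈ Submodule.span A (S : Set A) := hS ▸ hx
  induction hx using Submodule.span_induction with
  | mem x hxS =>
    obtain ⟨c, hc, e⟩ := h (algebraMap A K x) (.inr (by
      rw [Finset.coe_image]; exact Set.mem_image_of_mem _ hxS))
    exact ⟨⟨c, hc⟩, Subtype.ext e⟩
  | zero => exact ⟨0, by simp⟩
  | add x y _ _ hx hy =>
    obtain ⟨β, e⟩ := hx
    obtain ⟨β', e'⟩ := hy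
    exact ⟨β + β', by rw [map_add, e, e', mul_add]⟩
  | smul r x _ hx =>
    obtain ⟨β, e⟩ := hx
    exact ⟨algebraMap A C r * β, by rw [smul_eq_mul, map_mul, e, mul_left_comm]⟩

theorem exists_pow_mul_one_sub_mem {R : Type*} [CommRing R] {J : Ideal R} [IsArtinianRing (R ⧸ J)]
    (x : R) : ∃ (m : ℕ) (g : R), 1 ≤ m ∧ (1 - x ^ m * g) * x ^ m ∈ J := by
  obtain ⟨n, y, hy⟩ := IsArtinian.exists_pow_succ_smul_dvd (Ideal.Quotient.mk J x) (1 : R ⧸ J)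
  obtain ⟨y, rfl⟩ := Ideal.Quotient.mk_surjective y
  simp only [smul_eq_mul, mul_one, Nat.succ_eq_add_one] at hy
  have h (k : ℕ) : Ideal.Quotient.mk J x ^ (n + k) * Ideal.Quotient.mk J y ^ k =
      Ideal.Quotient.mk J x ^ n := by
    induction k with
    | zero => simp
    | succ k ih =>
      calc _ = Ideal.Quotient.mk J x ^ (n + 1) * Ideal.Quotient.mk J y *
            (Ideal.Quotient.mk J x ^ k * Ideal.Quotient.mk J y ^ k) := by ring
        _ = _ := by rw [hy, ← mul_assoc, ← pow_add, ih]
  -- The powers of `x` stabilise already at `n`; the exponent `n + 1` guarantees `1 ≤ m`.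
  refine ⟨n + 1, y ^ (n + 1), by omega, ?_⟩
  rw [← Ideal.Quotient.eq_zero_iff_mem, map_mul, map_sub, map_mul, map_pow, map_pow, map_one]
  calc _ = Ideal.Quotient.mk J x * (Ideal.Quotient.mk J x ^ n -
        Ideal.Quotient.mk J x ^ (n + (n + 1)) * Ideal.Quotient.mk J y ^ (n + 1)) := by ring
    _ = 0 := by rw [h, sub_self, mul_zero]

theorem Ideal.IsIntegrallyClosedIdeal.hasPrincipalReduction [IsFractionRing A K]
    [IsNoetherianRing A] [Finite (MaximalSpectrum A)]
    (hdim : ∀ s ∈ A⁰, ∀ P : Ideal A, P.IsPrime → s ∈ P → P.IsMaximal)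
    (hreg : ∀ M : Ideal A, M.IsMaximal → ∃ s ∈ M, s ∈ A⁰)
    (hSC : ∀ z : integralClosure A K, z ⊗ₜ[A] (1 : integralClosure A K) = 1 ⊗ₜ[A] z →
      ∃ r, algebraMap A K r = z)
    {I : Ideal A} (hI : ∃ s ∈ I, s ∈ A⁰) (hIc : I.IsIntegrallyClosedIdeal) :
    I.HasPrincipalReduction := by
  classical
  obtain ⟨C, hC, b, hbI, hb, hβ⟩ := exists_finite_subalgebra_map_eq_span_singleton (K := K) hdim hreg hI
  have hinj : Function.Injective (algebraMap A C) := fun x y hxy =>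
    IsFractionRing.injective A K (congrArg Subtype.val hxy)
  have hbcancel {x y : C} (h : b * x = b * y) : x = y :=
    Subtype.ext (hb.mul_left_cancel (congrArg Subtype.val h))
  have hmemI {w : A} {c : C} (h : algebraMap A C w = b * c) : w ∈ I :=
    hIc w (Ideal.isIntegralElem_of_algebraMap_mem_map hinj (h ▸ Ideal.mul_mem_right _ _ hbI))
  have hCint (c : C) : IsIntegral A (c : K) := (Algebra.IsIntegral.isIntegral (R := A) c).map C.val
  have := finite_maximalSpectrum_of_finite hdim hreg C
  have := Fintype.ofFinite (MaximalSpectrum C)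
  -- A regular element of the conductor, multiplied by a regular element of all maximal ideals of
  -- `A`; the second factor makes every maximal ideal of `C` visible in `C/c₀C`.
  obtain ⟨c₀, hc₀, hc₀C, hc₀n⟩ : ∃ c₀ ∈ A⁰, (∀ c : C, ∃ r : A, algebraMap A C r = c₀ • c) ∧
      ∀ n : MaximalSpectrum C, algebraMap A C c₀ ∈ n.asIdeal := by
    obtain ⟨s, hs, hsC⟩ := exists_mem_nonZeroDivisors_mul_mem C
    obtain ⟨j, hj, hjM⟩ := exists_mem_nonZeroDivisors_forall_mem_maximal hreg
    refine ⟨s * j, mul_mem hs hj, fun c => ?_, fun n => ?_⟩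
    · obtain ⟨r, hr⟩ := hsC (j • c : C) (j • c : C).2
      exact ⟨r, Subtype.ext (by rw [mul_smul, Subalgebra.coe_smul, Algebra.smul_def]; exact hr)⟩
    · rw [map_mul]
      have := n.isMaximal
      exact Ideal.mul_mem_left _ _ (hjM (n.asIdeal.comap (algebraMap A C))
        (Ideal.isMaximal_comap_of_isIntegral_of_isMaximal n.asIdeal))
  have := isArtinianRing_quotient_of_finite hdim hc₀ C
  have key (T : Finset (MaximalSpectrum C)) : ∃ x ∈ I, ∃ β : C, algebraMap A C x = b * β ∧
      ∀ n ∈ T, β ∉ n.asIdeal := by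
    induction T using Finset.induction_on with
    | empty => exact ⟨0, I.zero_mem, 0, by simp, by simp⟩
    | insert n₀ T _ ih =>
      obtain ⟨x, hx, β, hxβ, hT⟩ := ih
      by_cases hn₀ : β ∈ n₀.asIdeal
      swap
      · exact ⟨x, hx, β, hxβ, by simpa [hn₀] using hT⟩
      obtain ⟨y, hy, β', hyβ', hn₀'⟩ : ∃ y ∈ I, ∃ β' : C, algebraMap A C y = b * β' ∧
          β' ∉ n₀.asIdeal := by
        by_contra! hcon
        have hle : I.map (algebraMap A C) ≤ Ideal.span {b} * n₀.asIdeal := by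
          rw [Ideal.map_le_iff_le_comap]
          intro y hy
          obtain ⟨β', h⟩ := hβ y hy
          exact Ideal.mem_span_singleton_mul.2 ⟨β', hcon y hy β' h, h.symm⟩
        obtain ⟨c, hc, e⟩ := Ideal.mem_span_singleton_mul.1 (hle hbI)
        rw [hbcancel (e.trans (mul_one b).symm)] at hc
        exact n₀.isMaximal.ne_top ((Ideal.eq_top_iff_one _).2 hc)
      obtain ⟨m, g, hm, hmg⟩ := exists_pow_mul_one_sub_mem
        (J := Ideal.span {algebraMap A C c₀}) β
      obtain ⟨k, hk⟩ := Ideal.mem_span_singleton'.1 hmg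
      -- At a maximal ideal of `C`, `e` is `1` where `β` vanishes and `0` where it does not.
      -- Replacing `β` by `β + β' e` therefore repairs `n₀` without spoiling `T`.
      set e := 1 - β ^ m * g with he
      have hye := mul_tmul_one_eq_one_tmul_mul hbI hβ hc₀C hxβ hy (e := e) (g := g) (k := k) (m := m)
        (by rw [Algebra.smul_def, ← hk, mul_comm]) (by rw [he]; ring)
      obtain ⟨r, hr⟩ := hSC _ (tmul_one_eq_one_tmul_map
        (C.val.codRestrict (integralClosure A K) hCint) hye)
      have hr' : algebraMap A C r = algebraMap A C y * e := Subtype.ext hr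
      have hz : algebraMap A C (x + r) = b * (β + β' * e) := by
        rw [map_add, hr', hxβ, hyβ']
        ring
      refine ⟨x + r, hmemI hz, _, hz, fun n hn => ?_⟩
      have hnp := n.isMaximal.isPrime
      by_cases hβn : β ∈ n.asIdeal
      · obtain rfl : n = n₀ := (Finset.mem_insert.1 hn).resolve_right fun h => hT n h hβn
        have hen : e ∉ n.asIdeal := fun h => hnp.ne_top <| (Ideal.eq_top_iff_one _).2 <| by
          rw [show (1 : C) = e + β ^ m * g by rw [he]; ring]
          exact add_mem h (Ideal.mul_mem_right _ _ (Ideal.pow_mem_of_mem _ hβn m hm))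
        rw [Ideal.add_mem_iff_right _ hβn]
        exact fun h => (hnp.mem_or_mem h).elim hn₀' hen
      · have hen : e ∈ n.asIdeal := by
          have : e * β ^ m ∈ n.asIdeal := hk ▸ Ideal.mul_mem_left _ _ (hc₀n n)
          exact (hnp.mem_or_mem this).resolve_right fun h => hβn (hnp.mem_of_pow_mem m h)
        rwa [Ideal.add_mem_iff_left _ (Ideal.mul_mem_left _ _ hen)]
  obtain ⟨x, hx, β, hxβ, hT⟩ := key Finset.univ
  have hβu : IsUnit β := by
    by_contra h
    obtain ⟨n, hn, hβn⟩ := exists_max_ideal_of_mem_nonunits h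
    exact hT ⟨n, hn⟩ (Finset.mem_univ _) hβn
  obtain ⟨β, rfl⟩ := hβu
  have hdiv (y : A) (hy : y ∈ I) : ∃ c : C, algebraMap A C y = algebraMap A C x * c := by
    obtain ⟨β', h⟩ := hβ y hy
    exact ⟨↑β⁻¹ * β', by rw [h, hxβ, mul_assoc, Units.mul_inv_cancel_left]⟩
  -- Exponent `1` suffices: for `y = xc` and `z = xc'` in `I`, the element `xcc'` lies in `A` by
  -- condition 2 and in `bC`, hence in the integrally closed ideal `I`, so `yz ∈ xI`.
  refine ⟨x, hx, 1, ?_⟩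
  rw [pow_one, pow_two]
  refine le_antisymm (Ideal.mul_le.2 fun y hy z hz => ?_)
    (Ideal.mul_mono_left ((Ideal.span_singleton_le_iff_mem _).2 hx))
  obtain ⟨c, hc⟩ := hdiv y hy
  obtain ⟨c', hc'⟩ := hdiv z hz
  obtain ⟨r, hr⟩ := exists_eq_mul_mul_of_forall_tmul hSC (hCint c) (hCint c')
    (congrArg Subtype.val hc) (congrArg Subtype.val hc')
  have hr' : algebraMap A C r = algebraMap A C x * (c * c') := Subtype.ext hr
  refine Ideal.mem_span_singleton_mul.2 ⟨r, hmemI (c := β * (c * c')) ?_, hinj ?_⟩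
  · rw [hr', hxβ, mul_assoc]
  · rw [map_mul, hr', map_mul, hc, hc']
    ring

end

/-! ### The equivalence -/

theorem IsStrictlyClosed.exists_algebraMap_eq {A : Type*} [CommRing A] (h : IsStrictlyClosed A)
    (z : totalIntegralClosure A)
    (hz : z ⊗ₜ[A] (1 : totalIntegralClosure A) = 1 ⊗ₜ[A] z) :
    ∃ r, algebraMap A (FractionRing A) r = z := by
  have h1 : z ∈ strictClosure A := hz
  rw [h] at h1
  obtain ⟨r, rfl⟩ := Algebra.mem_bot.1 h1
  exact ⟨r, rfl⟩

theorem IsStrictlyClosed.isArfRing {A : Type*} [CommRing A] [IsNoetherianRing A]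
    [Finite (MaximalSpectrum A)] (h : IsStrictlyClosed A)
    (hdim : ∀ s ∈ A⁰, ∀ P : Ideal A, P.IsPrime → s ∈ P → P.IsMaximal)
    (hreg : ∀ M : Ideal A, M.IsMaximal → ∃ s ∈ M, s ∈ A⁰) : IsArfRing A where
  hasPrincipalReduction I hI hIc :=
    hIc.hasPrincipalReduction (K := FractionRing A) hdim hreg h.exists_algebraMap_eq hI
  mul_div_mem x y z hy hz := by
    obtain ⟨r, hr⟩ := exists_eq_mul_mul_of_forall_tmul h.exists_algebraMap_eq (x := x) hy hz
      (IsLocalization.mk'_spec' _ _ _).symm (IsLocalization.mk'_spec' _ _ _).symm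
    refine ⟨r, hr.trans ?_⟩
    rw [IsLocalization.eq_mk'_iff_mul_eq, map_mul, ← IsLocalization.mk'_spec' (FractionRing A) y x,
      ← IsLocalization.mk'_spec' (FractionRing A) z x]
    ring

theorem theorem4p3 (A : Type*) [CommRing A] [IsNoetherianRing A]
    (hsemilocal : Finite (MaximalSpectrum A))
    (hCM : ∀ (M : Ideal A) [M.IsMaximal],
      IsCohenMacaulayLocalRing (Localization.AtPrime M) ∧
        ringKrullDim (Localization.AtPrime M) = 1) :
    IsStrictlyClosed A ↔ IsArfRing A := by
  have hdim : ∀ s ∈ A⁰, ∀ P : Ideal A, P.IsPrime → s ∈ P → P.IsMaximal := fun s hs P _ hsP =>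
    isMaximal_of_ringKrullDim_eq_one (fun M _ => (hCM M).2) hs hsP
  have hreg : ∀ M : Ideal A, M.IsMaximal → ∃ s ∈ M, s ∈ A⁰ := fun M _ => by
    refine exists_mem_nonZeroDivisors_of_localRingDepth_ne_zero M fun h => ?_
    have h1 := (hCM M).1.depth_eq_dim
    rw [(hCM M).2, h] at h1
    exact zero_ne_one h1
  exact ⟨fun h => h.isArfRing hdim hreg, fun h => h.isStrictlyClosed hdim hreg⟩
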